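/- Theorem (Resolvent universality). There is a universal constant $C>0$ such that the following holds. Let $d\ge 2$, let $Z_0$ be a deterministic self-adjoint $d\times d$ complex matrix, let $Z_1,\dots,Z_n$ be independent self-adjoint random $d\times d$ complex matrices whose entries are square integrable with $\mathbf{E}[Z_i]=0$, and let $$X=Z_0+\sum_{i=1}^n Z_i .$$ Let $G$ be the Gaussian model of $X$: a self-adjoint $d\times d$ random matrix (on any probability space) whose entries have jointly Gaussian real and imaginary parts, with $\mathbf{E}[G]=\mathbf{E}[X]$ and $\mathrm{Cov}(G)=\mathrm{Cov}(X)$, where $\mathrm{Cov}(Y)_{ij,kl}=\mathbf{E}\big[(Y-\mathbf{E}Y)_{ij}\,\overline{(Y-\mathbf{E}Y)_{kl}}\big]$. Denote by $\|M\|$ the spectral norm, by $\mathrm{tr}\,M=\frac1d\mathrm{Tr}\,M$ the normalized trace, by $|M|=(M^*M)^{1/2}$ the modulus, and set $$\sigma(X)=\big\|\mathbf{E}[(X-\mathbf{E}X)^2]\big\|^{1/2},\qquad R(X)=\Big\|\max_{1\le i\le n}\|Z_i\|\Big\|_{\infty}\in[0,\infty]$$ (the essential supremum). Then for every integer $p\ge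 1$ and every $z\in\mathbb{C}$ with $\mathrm{Im}\,z>0$, $$\Big|\mathbf{E}\big[\mathrm{tr}\,|z\mathbf{1}-X|^{-2p}\big]^{\frac1{2p}}-\mathbf{E}\big[\mathrm{tr}\,|z\mathbf{1}-G|^{-2p}\big]^{\frac1{2p}}\Big|\le C\,\frac{R(X)\,\sigma(X)^2p^2+R(X)^3p^3}{(\mathrm{Im}\,z)^4}.$$ -/

import Mathlib

open MeasureTheory ProbabilityTheory
open scoped ENNReal

noncomputable section

namespace ResolventUniversality

/-- The spectral norm (largest singular value): the operator norm of the matrix acting on the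
Euclidean space `ℂ^d`. -/
def specNorm {m : Type*} [Fintype m] [DecidableEq m] (M : Matrix m m ℂ) : ℝ :=
  ‖Matrix.toEuclideanCLM (n := m) (𝕜 := ℂ) M‖

/-- The normalized trace `tr M = (1/d) Tr M`. -/
def ntr {d : ℕ} (M : Matrix (Fin d) (Fin d) ℂ) : ℂ :=
  (d : ℂ)⁻¹ * M.trace

section Modulus

open scoped MatrixOrder ComplexOrder Matrix.Norms.L2Operator

/-- The matrix modulus `|M| = (M* M)^{1/2}`, with the positive semidefinite square root. -/
def modulus {d : ℕ} (M : Matrix (Fin d) (Fin d) ℂ) : Matrix (Fin d) (Fin d) ℂ :=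
  CFC.abs M

/-- The modulus is positive semidefinite. -/
lemma modulus_posSemidef {d : ℕ} (M : Matrix (Fin d) (Fin d) ℂ) : (modulus M).PosSemidef :=
  Matrix.nonneg_iff_posSemidef.mp (CFC.abs_nonneg M)

/-- The square of the modulus is `M* M`. -/
lemma modulus_mul_modulus {d : ℕ} (M : Matrix (Fin d) (Fin d) ℂ) :
    modulus M * modulus M = M.conjTranspose * M :=
  CFC.abs_mul_abs M

end Modulus

/-- A self-adjoint random matrix: the entries are random variables and all values are
Hermitian. -/
structure IsSARandomMatrix {Ω : Type*} [MeasurableSpace Ω] {d : ℕ}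
    (Y : Ω → Matrix (Fin d) (Fin d) ℂ) : Prop where
  measurable_entry : ∀ a b, Measurable fun ω => Y ω a b
  isHermitian : ∀ ω, (Y ω).IsHermitian

/-- The entrywise expectation of a random matrix. -/
def expect {Ω : Type*} [MeasurableSpace Ω] (P : Measure Ω) {d : ℕ}
    (Y : Ω → Matrix (Fin d) (Fin d) ℂ) : Matrix (Fin d) (Fin d) ℂ :=
  Matrix.of fun a b => ∫ ω, Y ω a b ∂P

/-- The `d² × d²` covariance matrix of the entries,
`Cov(Y)_{ij,kl} = E[(Y - E Y)_{ij} conj((Y - E Y)_{kl})]`. -/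
def covMatrix {Ω : Type*} [MeasurableSpace Ω] (P : Measure Ω) {d : ℕ}
    (Y : Ω → Matrix (Fin d) (Fin d) ℂ) : Matrix (Fin d × Fin d) (Fin d × Fin d) ℂ :=
  Matrix.of fun a b =>
    ∫ ω, (Y ω - expect P Y) a.1 a.2 * star ((Y ω - expect P Y) b.1 b.2) ∂P

/-- `G` (under `Q`) is a Gaussian model of `X` (under `P`): a self-adjoint random matrix whose
real and imaginary parts of entries are jointly Gaussian, with the mean and covariance of `X`. -/
structure IsGaussianModel {Ω Ω' : Type*} [MeasurableSpace Ω] [MeasurableSpace Ω']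
    (P : Measure Ω) (Q : Measure Ω') {d : ℕ}
    (X : Ω → Matrix (Fin d) (Fin d) ℂ) (G : Ω' → Matrix (Fin d) (Fin d) ℂ) : Prop where
  saRandomMatrix : IsSARandomMatrix G
  jointlyGaussian :
    HasGaussianLaw (fun ω (a : Fin d × Fin d) => ((G ω a.1 a.2).re, (G ω a.1 a.2).im)) Q
  mean_eq : expect Q G = expect P X
  cov_eq : covMatrix Q G = covMatrix P X

/-- The random matrix `X = Z₀ + Z₁ + ⋯ + Zₙ`. -/
def model {Ω : Type*} {d n : ℕ} (Z₀ : Matrix (Fin d) (Fin d) ℂ)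
    (Z : Fin n → Ω → Matrix (Fin d) (Fin d) ℂ) (ω : Ω) : Matrix (Fin d) (Fin d) ℂ :=
  Z₀ + ∑ i, Z i ω

/-- `σ(X) = ‖E[(X - E X)²]‖^{1/2}`. -/
def sigma {Ω : Type*} [MeasurableSpace Ω] (P : Measure Ω) {d : ℕ}
    (X : Ω → Matrix (Fin d) (Fin d) ℂ) : ℝ :=
  √(specNorm (expect P fun ω => (X ω - expect P X) ^ 2))

/-- `R(X) = ‖ max_i ‖Z_i‖ ‖_∞`, an essential supremum that may be infinite. -/
def Rparam {Ω : Type*} [MeasurableSpace Ω] (P : Measure Ω) {d n : ℕ}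
    (Z : Fin n → Ω → Matrix (Fin d) (Fin d) ℂ) : ℝ≥0∞ :=
  eLpNorm (fun ω => ⨆ i, specNorm (Z i ω)) ∞ P

/-- `E[tr |z 1 - Y|^{-2p}]^{1/(2p)}`; the trace of the positive semidefinite matrix
`|z 1 - Y|^{-2p}` is real, so it is read off as a real part. -/
def resolventMoment {Ω : Type*} [MeasurableSpace Ω] (P : Measure Ω) {d : ℕ}
    (Y : Ω → Matrix (Fin d) (Fin d) ℂ) (z : ℂ) (p : ℕ) : ℝ :=
  (∫ ω, (ntr (modulus (z • 1 - Y ω) ^ (-(2 * (p : ℤ))))).re ∂P) ^ (1 / (2 * (p : ℝ)))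

end ResolventUniversality

end

open ResolventUniversality

/-!
The two matrices are joined by the rotation `X(θ) = Z₀ + sin θ ∑ Zᵢ + cos θ H`, where `H = G - Z₀`
is taken independent of the `Zᵢ`, and `φ(θ) = E Tr |z - X(θ)|^(-2p)` is shown to satisfy a
differential inequality `|φ'| ≤ L φ`. Write `A = (z - X(θ))⁻¹` and `η = Im z`, so that
`‖A‖ ≤ 1 / η`, and let `D¹`, `D²`, `D³` be the derivatives of `X ↦ Tr |z - X|^(-2p)`. Then

  `φ'(θ) = cos θ ∑ᵢ E D¹(X(θ))[Zᵢ] - sin θ E D¹(X(θ))[H]`.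

In the second term, Gaussian integration by parts (`integral_powTraceD1_gaussian`, a consequence
of the rotation invariance of a pair of independent Gaussian copies) and the equality of
covariances turn `E D¹(X(θ))[H]` into `cos θ ∑ᵢ E D²(X(θ))[Z'ᵢ, Z'ᵢ]`, with `Z'ᵢ` an independent
copy of `Zᵢ`. In the first term, `D¹` is expanded around the matrix `B` obtained from `X(θ)` by
deleting the summand `Zᵢ`: the zeroth-order term has mean zero, the first-order term is
`sin θ E D²(B)[Zᵢ, Zᵢ]`, and up to another third-order error this cancels the Gaussian term
(`abs_integral_powTraceD1_sub_le`).

What is left is a third derivative. It is a sum of `O(p³)` traces `Tr (M₁ Y₁ M₂ Y₂ M₃ Y₃)`, where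
the `Mⱼ` are monomials in `A` and `A*` of total degree `2p + 3`. As `A` is normal, Hölder's
inequality and the log-convexity of `k ↦ ‖A^k Y A^(m - k)‖` in the Hilbert–Schmidt norm bound each
of them by `R η⁻³ ∑ⱼ ‖A^p Yⱼ‖²` (`norm_trace_three_le`): only one of the three directions is
estimated in operator norm. The resolvents met in the Taylor expansion differ by a summand of norm
at most `R`. When `p R ≤ η / 6`, replacing one by the other changes the quantities `‖A^p Y‖²` by
constant factors only (`hs_res_add_pow_mul_sq_le`). Since the copy `Z'ᵢ` is independent of `A`,
summing over `i` gives

  `∑ᵢ E ‖A^p Z'ᵢ‖² = E Tr ((A^p)* A^p E[(∑ Zᵢ)²]) ≤ σ² φ`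

(`sum_integral_hs_mul_sq_le`), and hence `|φ'| ≤ 2016 p³ R σ² η⁻³ φ`. Together with
`φ ≤ d η^(-2p)` this shows that `(φ / d)^(1 / 2p)` is Lipschitz with the constant
`1008 p² R σ² η⁻⁴` (`abs_rpow_sub_rpow_le`). When `p R > η / 6`, the statement is trivial, because
both moments lie in `[0, 1 / η]` and `1 / η ≤ (6 p R)³ / η⁴`.
-/

noncomputable section

namespace ResolventUniversality

open scoped Matrix Matrix.Norms.L2Operator

variable {d : ℕ}

/-! ### The Hilbert–Schmidt norm -/

/-- The entries of a matrix as a vector of the Euclidean space `ℂ^(d × d)`. -/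
def hsVec (M : Matrix (Fin d) (Fin d) ℂ) : EuclideanSpace ℂ (Fin d × Fin d) :=
  WithLp.toLp 2 fun a => M a.1 a.2

/-- The (unnormalized) Hilbert–Schmidt norm of a matrix. The operator norm is the ambient norm
on matrices, so this one is kept as a separate function. -/
def hs (M : Matrix (Fin d) (Fin d) ℂ) : ℝ := ‖hsVec M‖

lemma hs_nonneg (M : Matrix (Fin d) (Fin d) ℂ) : 0 ≤ hs M := norm_nonneg _

lemma hs_sq (M : Matrix (Fin d) (Fin d) ℂ) : hs M ^ 2 = ∑ i, ∑ j, ‖M i j‖ ^ 2 := by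
  rw [hs, EuclideanSpace.norm_sq_eq, Fintype.sum_prod_type]
  rfl

lemma hs_add_le (M N : Matrix (Fin d) (Fin d) ℂ) : hs (M + N) ≤ hs M + hs N :=
  norm_add_le (hsVec M) (hsVec N)

lemma hs_neg (M : Matrix (Fin d) (Fin d) ℂ) : hs (-M) = hs M :=
  norm_neg (hsVec M)

lemma hs_smul (c : ℝ) (M : Matrix (Fin d) (Fin d) ℂ) : hs (c • M) = |c| * hs M :=
  norm_smul c (hsVec M)

lemma hs_zero : hs (0 : Matrix (Fin d) (Fin d) ℂ) = 0 :=
  norm_zero (E := EuclideanSpace ℂ (Fin d × Fin d))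

lemma hs_sum_le {ι : Type*} (s : Finset ι) (M : ι → Matrix (Fin d) (Fin d) ℂ) :
    hs (∑ i ∈ s, M i) ≤ ∑ i ∈ s, hs (M i) := by
  classical
  induction s using Finset.induction_on with
  | empty => simp [hs_zero]
  | insert i s hi ih =>
    rw [Finset.sum_insert hi, Finset.sum_insert hi]
    exact (hs_add_le _ _).trans (by gcongr)

lemma hs_conjTranspose (M : Matrix (Fin d) (Fin d) ℂ) : hs Mᴴ = hs M := by
  rw [← sq_eq_sq₀ (hs_nonneg _) (hs_nonneg _), hs_sq, hs_sq, Finset.sum_comm]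
  simp [Matrix.conjTranspose_apply]

lemma hs_sq_eq_trace (M : Matrix (Fin d) (Fin d) ℂ) : hs M ^ 2 = (Mᴴ * M).trace.re := by
  rw [hs_sq, Finset.sum_comm]
  simp only [Matrix.trace, Matrix.diag, Matrix.mul_apply, Matrix.conjTranspose_apply,
    Complex.re_sum]
  refine Finset.sum_congr rfl fun i _ => Finset.sum_congr rfl fun j _ => ?_
  rw [Complex.star_def, ← Complex.normSq_eq_conj_mul_self, Complex.ofReal_re,
    Complex.normSq_eq_norm_sq]

lemma norm_trace_mul_le (M N : Matrix (Fin d) (Fin d) ℂ) :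
    ‖(M * N).trace‖ ≤ hs M * hs N := by
  have h : (M * N).trace = inner ℂ (hsVec Mᴴ) (hsVec N) := by
    simp only [Matrix.trace, Matrix.diag, Matrix.mul_apply, hsVec, PiLp.inner_apply,
      Fintype.sum_prod_type, Matrix.conjTranspose_apply]
    rw [Finset.sum_comm]
    simp [mul_comm]
  rw [h, ← hs_conjTranspose M]
  exact norm_inner_le_norm _ _

lemma hs_mul_le (M N : Matrix (Fin d) (Fin d) ℂ) : hs (M * N) ≤ ‖M‖ * hs N := by
  rw [← abs_of_nonneg (hs_nonneg (M * N)),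
    ← abs_of_nonneg (mul_nonneg (norm_nonneg M) (hs_nonneg N)), ← sq_le_sq, mul_pow, hs_sq, hs_sq,
    Finset.sum_comm, Finset.sum_comm (f := fun i j => ‖N i j‖ ^ 2), Finset.mul_sum]
  refine Finset.sum_le_sum fun j _ => ?_
  have h := Matrix.l2_opNorm_mulVec M (WithLp.toLp 2 fun i => N i j)
  have h2 := pow_le_pow_left₀ (norm_nonneg _) h 2
  rw [mul_pow, EuclideanSpace.norm_sq_eq, EuclideanSpace.norm_sq_eq] at h2
  exact h2

lemma hs_mul_le' (M N : Matrix (Fin d) (Fin d) ℂ) : hs (M * N) ≤ hs M * ‖N‖ := by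
  rw [← hs_conjTranspose, Matrix.conjTranspose_mul, ← hs_conjTranspose M,
    ← Matrix.l2_opNorm_conjTranspose N, mul_comm (hs Mᴴ)]
  exact hs_mul_le _ _

/-! ### Normal matrices -/

lemma hs_conjTranspose_mul_of_normal {A : Matrix (Fin d) (Fin d) ℂ} (hA : Commute A Aᴴ)
    (N : Matrix (Fin d) (Fin d) ℂ) : hs (Aᴴ * N) = hs (A * N) := by
  rw [← sq_eq_sq₀ (hs_nonneg _) (hs_nonneg _), hs_sq_eq_trace, hs_sq_eq_trace]
  congr 2
  simp only [Matrix.conjTranspose_mul, Matrix.conjTranspose_conjTranspose, Matrix.mul_assoc]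
  rw [← Matrix.mul_assoc A, ← Matrix.mul_assoc Aᴴ, hA.eq]

lemma hs_mul_conjTranspose_of_normal {A : Matrix (Fin d) (Fin d) ℂ} (hA : Commute A Aᴴ)
    (N : Matrix (Fin d) (Fin d) ℂ) : hs (N * Aᴴ) = hs (N * A) := by
  rw [← hs_conjTranspose, ← hs_conjTranspose (N * A), Matrix.conjTranspose_mul,
    Matrix.conjTranspose_mul, Matrix.conjTranspose_conjTranspose,
    hs_conjTranspose_mul_of_normal hA]

/-- For normal `A`, a monomial in `A` and `A*` acts on the Hilbert–Schmidt norm only through its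
degree. -/
lemma hs_monomial_mul {A : Matrix (Fin d) (Fin d) ℂ} (hA : Commute A Aᴴ)
    (N : Matrix (Fin d) (Fin d) ℂ) (a b : ℕ) :
    hs (A ^ a * Aᴴ ^ b * N) = hs (A ^ (a + b) * N) := by
  induction b generalizing a with
  | zero => simp
  | succ b ih =>
    have h : A ^ a * Aᴴ ^ (b + 1) * N = Aᴴ * (A ^ a * Aᴴ ^ b * N) := by
      rw [pow_succ', ← mul_assoc, ← mul_assoc, ← mul_assoc, (hA.pow_left a).eq]
    rw [h, hs_conjTranspose_mul_of_normal hA, ← mul_assoc, ← mul_assoc, ← pow_succ', ih]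
    congr 3; ring

lemma hs_mul_monomial {A : Matrix (Fin d) (Fin d) ℂ} (hA : Commute A Aᴴ)
    (N : Matrix (Fin d) (Fin d) ℂ) (a b : ℕ) :
    hs (N * (A ^ a * Aᴴ ^ b)) = hs (N * A ^ (a + b)) := by
  induction b generalizing a with
  | zero => simp
  | succ b ih =>
    have h : N * (A ^ a * Aᴴ ^ (b + 1)) = N * (A ^ a * Aᴴ ^ b) * Aᴴ := by
      rw [pow_succ]; simp only [mul_assoc]
    have h2 : N * (A ^ a * Aᴴ ^ b) * A = N * (A ^ (a + 1) * Aᴴ ^ b) := by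
      rw [pow_succ]; simp only [mul_assoc]; rw [(hA.pow_right b).eq]
    rw [h, hs_mul_conjTranspose_of_normal hA, h2, ih]
    congr 3; ring

/-- Taking adjoints turns `Y A^m` into `(A*)^m Y`, and `A` is normal. -/
lemma hs_mul_pow_of_isHermitian {A : Matrix (Fin d) (Fin d) ℂ} (hA : Commute A Aᴴ)
    {Y : Matrix (Fin d) (Fin d) ℂ} (hY : Y.IsHermitian) (m : ℕ) :
    hs (Y * A ^ m) = hs (A ^ m * Y) := by
  have h := hs_monomial_mul hA Y 0 m
  rw [pow_zero, one_mul, zero_add] at h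
  rw [← hs_conjTranspose, Matrix.conjTranspose_mul, hY.eq, Matrix.conjTranspose_pow, h]

/-- The basic log-convexity step: moving one factor from the right of `B V A` to its left, or
conversely, is a Cauchy–Schwarz inequality, since a normal factor may be replaced by its adjoint. -/
lemma hs_mul_mul_sq_le {A B : Matrix (Fin d) (Fin d) ℂ} (hA : Commute A Aᴴ) (hB : Commute B Bᴴ)
    (V : Matrix (Fin d) (Fin d) ℂ) : hs (B * V * A) ^ 2 ≤ hs (B * (B * V)) * hs (V * A * A) := by
  have h : (B * V * A)ᴴ * (B * V * A) = Aᴴ * ((Bᴴ * (B * V))ᴴ * (V * A)) := by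
    simp only [Matrix.conjTranspose_mul, Matrix.conjTranspose_conjTranspose, mul_assoc]
  rw [hs_sq_eq_trace, h, Matrix.trace_mul_comm, mul_assoc]
  refine (Complex.re_le_norm _).trans ((norm_trace_mul_le _ _).trans ?_)
  rw [hs_conjTranspose, hs_conjTranspose_mul_of_normal hB, hs_mul_conjTranspose_of_normal hA]

/-- A nonnegative midpoint-logarithmically-convex finite sequence is bounded by the larger of its
end values. -/
lemma le_max_of_sq_le_mul {u : ℕ → ℝ} {m : ℕ} (h0 : ∀ k, 0 ≤ u k)
    (h : ∀ k, k + 2 ≤ m → u (k + 1) ^ 2 ≤ u k * u (k + 2)) {k : ℕ} (hk : k ≤ m) :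
    u k ≤ max (u 0) (u m) := by
  -- Once the sequence exceeds its initial value it can only increase.
  have key : ∀ j, j + 1 ≤ m → u 0 < u (j + 1) → u j ≤ u (j + 1) := by
    intro j
    induction j with
    | zero => intro _ h1; exact h1.le
    | succ j ih =>
      intro hj h1
      by_contra hlt
      push Not at hlt
      have h2 := ih (by omega) (h1.trans hlt)
      have h3 := h j (by omega)
      have h4 := h0 j
      have h5 := h0 (j + 2)
      have h6 : j + 1 + 1 = j + 2 := rfl
      rw [h6] at hlt
      nlinarith [h0 (j + 1)]
  by_cases hk0 : u k ≤ u 0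
  · exact hk0.trans (le_max_left _ _)
  push Not at hk0
  refine le_trans ?_ (le_max_right _ _)
  have mono : ∀ j, k + j ≤ m → u k ≤ u (k + j) := by
    intro j
    induction j with
    | zero => intro _; exact le_rfl
    | succ j ih =>
      intro hj
      have h1 := ih (by omega)
      by_contra hlt
      push Not at hlt
      -- the first descent contradicts the log-convexity and the previous increase
      rcases Nat.eq_zero_or_pos (k + j) with h0' | hpos
      · have : k = 0 := by omega
        subst this
        exact lt_irrefl _ hk0
      · obtain ⟨i, hi⟩ : ∃ i, k + j = i + 1 := ⟨k + j - 1, by omega⟩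
        have h2 := key i (by omega) (by rw [← hi]; linarith)
        have h3 := h i (by omega)
        have h6 : k + (j + 1) = i + 2 := by omega
        rw [h6] at hlt
        rw [hi] at h1
        have h4 := h0 i
        have h5 := h0 (i + 2)
        have := h0 0
        nlinarith [h0 (i + 1)]
  have := mono (m - k) (by omega)
  rwa [Nat.add_sub_cancel' hk] at this

/-- The three lines bound for the Hilbert–Schmidt norm, in discrete form. -/
lemma hs_pow_mul_mul_pow_le {A B : Matrix (Fin d) (Fin d) ℂ} (hA : Commute A Aᴴ)
    (hB : Commute B Bᴴ) (Y : Matrix (Fin d) (Fin d) ℂ) {k m : ℕ} (hk : k ≤ m) :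
    hs (B ^ k * Y * A ^ (m - k)) ≤ max (hs (Y * A ^ m)) (hs (B ^ m * Y)) := by
  have := le_max_of_sq_le_mul (u := fun k => hs (B ^ k * Y * A ^ (m - k))) (m := m)
    (fun k => hs_nonneg _) ?_ hk
  · simpa using this
  · intro k hk
    obtain ⟨l, rfl⟩ := Nat.exists_eq_add_of_le hk
    have h := hs_mul_mul_sq_le hA hB (B ^ k * Y * A ^ l)
    have e1 : k + 2 + l - (k + 1) = l + 1 := by omega
    have e2 : k + 2 + l - k = l + 1 + 1 := by omega
    have e3 : k + 2 + l - (k + 2) = l := by omega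
    simp only [e1, e2, e3]
    rw [mul_comm]
    convert h using 3
    · simp only [pow_succ', pow_succ A, mul_assoc]
    · simp only [pow_succ' B (k+1), pow_succ' B k, mul_assoc]
    · simp only [pow_succ, mul_assoc]

/-! ### Monomials in a normal matrix and its adjoint -/

/-- `M` is a product of `m` factors, each of them `A` or `A*`; since this is used for normal `A`,
the factors `A` are put first. -/
def IsMonomial (A : Matrix (Fin d) (Fin d) ℂ) (m : ℕ) (M : Matrix (Fin d) (Fin d) ℂ) : Prop :=
  ∃ a b, a + b = m ∧ M = A ^ a * Aᴴ ^ b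

lemma isMonomial_pow (A : Matrix (Fin d) (Fin d) ℂ) (m : ℕ) : IsMonomial A m (A ^ m) :=
  ⟨m, 0, by simp, by simp⟩

lemma isMonomial_conjTranspose_pow (A : Matrix (Fin d) (Fin d) ℂ) (m : ℕ) :
    IsMonomial A m (Aᴴ ^ m) :=
  ⟨0, m, by simp, by simp⟩

lemma isMonomial_pow_mul (A : Matrix (Fin d) (Fin d) ℂ) (a b : ℕ) :
    IsMonomial A (a + b) (A ^ a * Aᴴ ^ b) :=
  ⟨a, b, rfl, rfl⟩

/-- A monomial in a normal matrix and its adjoint factors with any prescribed degrees. -/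
lemma IsMonomial.split {A M : Matrix (Fin d) (Fin d) ℂ} (hA : Commute A Aᴴ) {m n : ℕ}
    (h : IsMonomial A (m + n) M) :
    ∃ M' M'', IsMonomial A m M' ∧ IsMonomial A n M'' ∧ M = M' * M'' := by
  obtain ⟨a, b, hab, rfl⟩ := h
  refine ⟨A ^ min a m * Aᴴ ^ (m - min a m), A ^ (a - min a m) * Aᴴ ^ (b - (m - min a m)),
    ⟨_, _, by omega, rfl⟩, ⟨_, _, by omega, rfl⟩, ?_⟩
  have e1 : a = min a m + (a - min a m) := by omega
  have e2 : b = (m - min a m) + (b - (m - min a m)) := by omega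
  conv_lhs => rw [e1, e2, pow_add, pow_add]
  have hc : Commute (A ^ (a - min a m)) (Aᴴ ^ (m - min a m)) := hA.pow_pow _ _
  simp only [mul_assoc]
  rw [← mul_assoc (A ^ (a - min a m)) (Aᴴ ^ (m - min a m)), hc.eq]
  simp only [mul_assoc]

lemma IsMonomial.hs_mul_mul {A M N : Matrix (Fin d) (Fin d) ℂ} (hA : Commute A Aᴴ) {m n : ℕ}
    (hM : IsMonomial A m M) (hN : IsMonomial A n N) (Y : Matrix (Fin d) (Fin d) ℂ) :
    hs (M * Y * N) = hs (A ^ m * Y * A ^ n) := by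
  obtain ⟨a, b, rfl, rfl⟩ := hM
  obtain ⟨a', b', rfl, rfl⟩ := hN
  rw [mul_assoc, hs_monomial_mul hA, ← mul_assoc, hs_mul_monomial hA]

lemma IsMonomial.norm_le {A M : Matrix (Fin d) (Fin d) ℂ} (hM : IsMonomial A 1 M) :
    ‖M‖ ≤ ‖A‖ := by
  obtain ⟨a, b, hab, rfl⟩ := hM
  rcases Nat.eq_zero_or_pos a with rfl | ha
  · obtain rfl : b = 1 := by omega
    simp [Matrix.l2_opNorm_conjTranspose]
  · obtain rfl : b = 0 := by omega
    obtain rfl : a = 1 := by omega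
    simp

/-- For Hermitian `Y`, powers of a normal `A` on the two sides of `Y` may all be collected on the
left. -/
lemma hs_pow_mul_mul_pow_le_of_isHermitian {A Y : Matrix (Fin d) (Fin d) ℂ} (hA : Commute A Aᴴ)
    (hY : Y.IsHermitian) {k l m : ℕ} (h : k + l = m) :
    hs (A ^ k * Y * A ^ l) ≤ hs (A ^ m * Y) := by
  have := hs_pow_mul_mul_pow_le hA hA Y (k := k) (m := m) (by omega)
  rwa [hs_mul_pow_of_isHermitian hA hY, max_self, show m - k = l by omega] at this

/-! ### Traces of products of three perturbations -/

/-- Hölder's inequality: one factor of degree one is split off on either side of `Y₂`, and the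
remaining two groups are estimated in the Hilbert–Schmidt norm. -/
lemma norm_trace_three_le_aux {A M₁ M₂ M₃ Y₁ Y₂ Y₃ : Matrix (Fin d) (Fin d) ℂ} {r R : ℝ}
    {p n₁ n₂ n₃ : ℕ} (hA : Commute A Aᴴ) (hr : ‖A‖ ≤ r)
    (h₁ : IsMonomial A n₁ M₁) (h₂ : IsMonomial A n₂ M₂) (h₃ : IsMonomial A n₃ M₃)
    (hn : n₁ + n₂ + n₃ = 2 * p + 3) (hn₂ : 1 ≤ n₂) (hn₂' : n₂ ≤ p + 1) (hn₃ : 1 ≤ n₃)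
    (hn₃' : n₃ ≤ p + 1) (hY₁ : Y₁.IsHermitian) (hY₃ : Y₃.IsHermitian) (hY₂ : ‖Y₂‖ ≤ R) :
    ‖(M₁ * Y₁ * M₂ * Y₂ * M₃ * Y₃).trace‖ ≤ R * r ^ 3 * (hs (A ^ p * Y₁) * hs (A ^ p * Y₃)) := by
  have hr0 : 0 ≤ r := (norm_nonneg _).trans hr
  have hR0 : 0 ≤ R := (norm_nonneg _).trans hY₂
  obtain ⟨k₂, rfl⟩ := Nat.exists_eq_add_of_le' hn₂
  obtain ⟨k₃, rfl⟩ := Nat.exists_eq_add_of_le hn₃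
  obtain rfl : n₁ = (p + 1 - k₃) + (p - k₂) := by omega
  obtain ⟨N₁, L₁, hN₁, hL₁, rfl⟩ := h₁.split hA
  obtain ⟨N₂, L₂, hN₂, hL₂, rfl⟩ := h₂.split hA
  obtain ⟨N₃, L₃, hN₃, hL₃, rfl⟩ := h₃.split hA
  have e : (N₁ * L₁ * Y₁ * (N₂ * L₂) * Y₂ * (N₃ * L₃) * Y₃).trace
      = ((L₁ * Y₁ * N₂) * ((L₂ * Y₂ * N₃) * (L₃ * Y₃ * N₁))).trace := by
    simp only [mul_assoc]
    rw [Matrix.trace_mul_comm]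
    simp only [mul_assoc]
  have b1 : hs (L₁ * Y₁ * N₂) ≤ hs (A ^ p * Y₁) := by
    rw [hL₁.hs_mul_mul hA hN₂]
    exact hs_pow_mul_mul_pow_le_of_isHermitian hA hY₁ (by omega)
  have b3 : hs (L₃ * Y₃ * N₁) ≤ hs (A ^ p * Y₃) * r := by
    rw [hL₃.hs_mul_mul hA hN₁, show p + 1 - k₃ = (p - k₃) + 1 by omega, pow_succ, ← mul_assoc]
    refine (hs_mul_le' _ _).trans ?_
    gcongr
    · exact hs_nonneg _
    · exact hs_pow_mul_mul_pow_le_of_isHermitian hA hY₃ (by omega)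
  have b2 : ‖L₂ * Y₂ * N₃‖ ≤ r * R * r := by
    refine (norm_mul_le _ _).trans ?_
    gcongr
    · refine (norm_mul_le _ _).trans ?_
      gcongr
      exact hL₂.norm_le.trans hr
    · exact hN₃.norm_le.trans hr
  rw [e]
  refine (norm_trace_mul_le _ _).trans ?_
  calc hs (L₁ * Y₁ * N₂) * hs (L₂ * Y₂ * N₃ * (L₃ * Y₃ * N₁))
      ≤ hs (A ^ p * Y₁) * ((r * R * r) * (hs (A ^ p * Y₃) * r)) := by
        refine mul_le_mul b1 ((hs_mul_le _ _).trans ?_) (hs_nonneg _) (hs_nonneg _)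
        exact mul_le_mul b2 b3 (hs_nonneg _) (by positivity)
    _ = _ := by ring

/-- The trilinear estimate. Each monomial has degree at least one, and only one of the three
perturbations is estimated in operator norm, by `R`. -/
lemma norm_trace_three_le {A M₁ M₂ M₃ Y₁ Y₂ Y₃ : Matrix (Fin d) (Fin d) ℂ} {r R : ℝ}
    {p n₁ n₂ n₃ : ℕ} (hA : Commute A Aᴴ) (hr : ‖A‖ ≤ r)
    (h₁ : IsMonomial A n₁ M₁) (h₂ : IsMonomial A n₂ M₂) (h₃ : IsMonomial A n₃ M₃)
    (hn : n₁ + n₂ + n₃ = 2 * p + 3) (hn₁ : 1 ≤ n₁) (hn₂ : 1 ≤ n₂) (hn₃ : 1 ≤ n₃)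
    (hY₁ : Y₁.IsHermitian) (hY₂ : Y₂.IsHermitian) (hY₃ : Y₃.IsHermitian)
    (hR₁ : ‖Y₁‖ ≤ R) (hR₂ : ‖Y₂‖ ≤ R) (hR₃ : ‖Y₃‖ ≤ R) :
    ‖(M₁ * Y₁ * M₂ * Y₂ * M₃ * Y₃).trace‖ ≤
      R * r ^ 3 * (hs (A ^ p * Y₁) ^ 2 + hs (A ^ p * Y₂) ^ 2 + hs (A ^ p * Y₃) ^ 2) := by
  have hr0 : 0 ≤ r := (norm_nonneg _).trans hr
  have hR0 : 0 ≤ R := (norm_nonneg _).trans hR₂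
  have hK : 0 ≤ R * r ^ 3 := by positivity
  -- At most one of the degrees exceeds `p + 1`; rotate it to the front.
  by_cases c2 : n₂ ≤ p + 1
  · by_cases c3 : n₃ ≤ p + 1
    · refine (norm_trace_three_le_aux hA hr h₁ h₂ h₃ hn hn₂ c2 hn₃ c3 hY₁ hY₃ hR₂).trans ?_
      refine mul_le_mul_of_nonneg_left ?_ hK
      nlinarith [sq_nonneg (hs (A ^ p * Y₁) - hs (A ^ p * Y₃)), sq_nonneg (hs (A ^ p * Y₂)),
        sq_nonneg (hs (A ^ p * Y₁)), sq_nonneg (hs (A ^ p * Y₃))]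
    · have e : (M₁ * Y₁ * M₂ * Y₂ * M₃ * Y₃).trace = (M₃ * Y₃ * M₁ * Y₁ * M₂ * Y₂).trace := by
        rw [mul_assoc (M₁ * Y₁ * M₂ * Y₂), Matrix.trace_mul_comm]
        simp only [mul_assoc]
      rw [e]
      refine (norm_trace_three_le_aux hA hr h₃ h₁ h₂ (p := p) (by omega) hn₁ (by omega) hn₂ c2
        hY₃ hY₂ hR₁).trans ?_
      refine mul_le_mul_of_nonneg_left ?_ hK
      nlinarith [sq_nonneg (hs (A ^ p * Y₂) - hs (A ^ p * Y₃)), sq_nonneg (hs (A ^ p * Y₂)),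
        sq_nonneg (hs (A ^ p * Y₁)), sq_nonneg (hs (A ^ p * Y₃))]
  · have e : (M₁ * Y₁ * M₂ * Y₂ * M₃ * Y₃).trace = (M₂ * Y₂ * M₃ * Y₃ * M₁ * Y₁).trace := by
      simp only [mul_assoc]
      rw [← mul_assoc M₁ Y₁, Matrix.trace_mul_comm]
      simp only [mul_assoc]
    rw [e]
    refine (norm_trace_three_le_aux hA hr h₂ h₃ h₁ (p := p) (by omega) hn₃ (by omega) hn₁
      (by omega) hY₂ hY₁ hR₃).trans ?_
    refine mul_le_mul_of_nonneg_left ?_ hK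
    nlinarith [sq_nonneg (hs (A ^ p * Y₁) - hs (A ^ p * Y₂)), sq_nonneg (hs (A ^ p * Y₂)),
      sq_nonneg (hs (A ^ p * Y₁)), sq_nonneg (hs (A ^ p * Y₃))]

/-! ### Derivatives of powers of a resolvent -/

/-- The derivative of `A ^ m` when `A` moves with velocity `A Y A`, as a resolvent does when its
matrix moves with velocity `Y`. -/
def dpow (A Y : Matrix (Fin d) (Fin d) ℂ) (m : ℕ) : Matrix (Fin d) (Fin d) ℂ :=
  ∑ k ∈ Finset.range m, A ^ (k + 1) * Y * A ^ (m - k)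

/-- The derivative of `dpow A Y m` when `A` moves with velocity `A Y' A`. -/
def d2pow (A Y Y' : Matrix (Fin d) (Fin d) ℂ) (m : ℕ) : Matrix (Fin d) (Fin d) ℂ :=
  ∑ k ∈ Finset.range m,
    (dpow A Y' (k + 1) * Y * A ^ (m - k) + A ^ (k + 1) * Y * dpow A Y' (m - k))

lemma dpow_succ (A Y : Matrix (Fin d) (Fin d) ℂ) (m : ℕ) :
    dpow A Y (m + 1) = A * dpow A Y m + A * Y * A ^ (m + 1) := by
  rw [dpow, Finset.sum_range_succ', dpow, Finset.mul_sum]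
  simp only [zero_add, pow_one, Nat.sub_zero]
  congr 1
  refine Finset.sum_congr rfl fun k _ => ?_
  rw [Nat.add_sub_add_right, pow_succ' A (k + 1)]
  simp only [mul_assoc]

lemma dpow_conjTranspose (A Y : Matrix (Fin d) (Fin d) ℂ) (hY : Y.IsHermitian) (m : ℕ) :
    (dpow A Y m)ᴴ = dpow Aᴴ Y m := by
  rw [dpow, dpow, Matrix.conjTranspose_sum, ← Finset.sum_range_reflect]
  refine Finset.sum_congr rfl fun k hk => ?_
  have hk' := Finset.mem_range.mp hk
  rw [Matrix.conjTranspose_mul, Matrix.conjTranspose_mul, hY.eq, Matrix.conjTranspose_pow,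
    Matrix.conjTranspose_pow, ← mul_assoc]
  congr 3 <;> omega

/-- The resolvent identity for powers. -/
lemma pow_sub_pow_eq_of_sub_eq {A B D : Matrix (Fin d) (Fin d) ℂ} (h : B - A = B * D * A) (p : ℕ) :
    B ^ p - A ^ p = ∑ k ∈ Finset.range p, B ^ (k + 1) * D * A ^ (p - k) := by
  induction p with
  | zero => simp
  | succ p ih =>
    have e : B ^ (p + 1) - A ^ (p + 1) = B * (B ^ p - A ^ p) + (B - A) * A ^ p := by
      rw [pow_succ', pow_succ']; noncomm_ring
    rw [e, ih, h, Finset.sum_range_succ', Finset.mul_sum]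
    simp only [zero_add, pow_one, Nat.sub_zero]
    congr 1
    · refine Finset.sum_congr rfl fun k _ => ?_
      rw [Nat.add_sub_add_right, pow_succ' B (k + 1)]
      simp only [mul_assoc]
    · rw [pow_succ' A p]; simp only [mul_assoc]

/-- Replacing the resolvent `A` by the resolvent `B` of a perturbation by `D` changes the
Hilbert–Schmidt norm of `A ^ p * Y` by a quantity involving `D` only through `A ^ p * D` and
`B ^ p * D`. -/
lemma hs_pow_mul_le_add {A B D Y : Matrix (Fin d) (Fin d) ℂ} {r R : ℝ} (hA : Commute A Aᴴ)
    (hB : Commute B Bᴴ) (hr : ‖A‖ ≤ r) (hD : D.IsHermitian) (hY : ‖Y‖ ≤ R)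
    (h : B - A = B * D * A) (p : ℕ) :
    hs (B ^ p * Y) ≤ hs (A ^ p * Y) + p * R * r * (hs (B ^ p * D) + hs (A ^ p * D)) := by
  have hr0 : 0 ≤ r := (norm_nonneg _).trans hr
  have hR0 : 0 ≤ R := (norm_nonneg _).trans hY
  have e : B ^ p * Y = A ^ p * Y + (∑ k ∈ Finset.range p, B ^ (k + 1) * D * A ^ (p - k)) * Y := by
    rw [← pow_sub_pow_eq_of_sub_eq h]; noncomm_ring
  rw [e]
  refine (hs_add_le _ _).trans (add_le_add le_rfl ?_)
  refine (hs_mul_le' _ _).trans ?_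
  have hsum : hs (∑ k ∈ Finset.range p, B ^ (k + 1) * D * A ^ (p - k)) ≤
      p * (r * (hs (B ^ p * D) + hs (A ^ p * D))) := by
    refine (hs_sum_le _ _).trans ?_
    rw [← nsmul_eq_mul]
    refine (Finset.sum_le_card_nsmul _ _ (r * (hs (B ^ p * D) + hs (A ^ p * D))) ?_).trans
      (by rw [Finset.card_range])
    intro k hk
    have hk' := Finset.mem_range.mp hk
    rw [show p - k = (p - (k + 1)) + 1 by omega, pow_succ A, ← mul_assoc, mul_comm r]
    refine (hs_mul_le' _ _).trans (mul_le_mul ?_ hr (norm_nonneg _)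
      (add_nonneg (hs_nonneg _) (hs_nonneg _)))
    refine (hs_pow_mul_mul_pow_le hA hB D (by omega)).trans ?_
    rw [hs_mul_pow_of_isHermitian hA hD]
    exact max_le (le_add_of_nonneg_left (hs_nonneg _)) (le_add_of_nonneg_right (hs_nonneg _))
  calc _ ≤ p * (r * (hs (B ^ p * D) + hs (A ^ p * D))) * R :=
        mul_le_mul hsum hY (norm_nonneg _) (by
          have := hs_nonneg (B ^ p * D); have := hs_nonneg (A ^ p * D); positivity)
    _ = _ := by ring

/-- The second derivative of `A ^ m` is a sum of `m (m + 1)` monomials. -/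
lemma norm_trace_d2pow_mul_le {A Y Y' Q : Matrix (Fin d) (Fin d) ℂ} {m : ℕ} {K : ℝ}
    (h₁ : ∀ k j, k < m → j ≤ k →
      ‖(A ^ (j + 1) * Y' * A ^ (k + 1 - j) * Y * (A ^ (m - k) * Q)).trace‖ ≤ K)
    (h₂ : ∀ k j, k < m → j < m - k →
      ‖(A ^ (k + 1) * Y * A ^ (j + 1) * Y' * (A ^ (m - k - j) * Q)).trace‖ ≤ K) :
    ‖(d2pow A Y Y' m * Q).trace‖ ≤ m * (m + 1) * K := by
  have hk : ∀ k ∈ Finset.range m,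
      ‖((dpow A Y' (k + 1) * Y * A ^ (m - k) + A ^ (k + 1) * Y * dpow A Y' (m - k)) * Q).trace‖
        ≤ (m + 1) * K := by
    intro k hk
    have hk' := Finset.mem_range.mp hk
    rw [add_mul, Matrix.trace_add]
    have e1 : (dpow A Y' (k + 1) * Y * A ^ (m - k) * Q).trace = ∑ j ∈ Finset.range (k + 1),
        (A ^ (j + 1) * Y' * A ^ (k + 1 - j) * Y * (A ^ (m - k) * Q)).trace := by
      rw [dpow, Finset.sum_mul, Finset.sum_mul, Finset.sum_mul, Matrix.trace_sum]
      simp only [mul_assoc]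
    have e2 : (A ^ (k + 1) * Y * dpow A Y' (m - k) * Q).trace = ∑ j ∈ Finset.range (m - k),
        (A ^ (k + 1) * Y * A ^ (j + 1) * Y' * (A ^ (m - k - j) * Q)).trace := by
      rw [dpow, Finset.mul_sum, Finset.sum_mul, Matrix.trace_sum]
      simp only [mul_assoc]
    rw [e1, e2]
    have b1 := norm_sum_le_of_le (Finset.range (k + 1)) (f := fun j =>
        (A ^ (j + 1) * Y' * A ^ (k + 1 - j) * Y * (A ^ (m - k) * Q)).trace) (n := fun _ => K)
      (fun j hj => h₁ k j hk' (by have := Finset.mem_range.mp hj; omega))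
    have b2 := norm_sum_le_of_le (Finset.range (m - k)) (f := fun j =>
        (A ^ (k + 1) * Y * A ^ (j + 1) * Y' * (A ^ (m - k - j) * Q)).trace) (n := fun _ => K)
      (fun j hj => h₂ k j hk' (Finset.mem_range.mp hj))
    refine (norm_add_le _ _).trans ((add_le_add b1 b2).trans (le_of_eq ?_))
    rw [Finset.sum_const, Finset.sum_const, Finset.card_range, Finset.card_range, ← add_nsmul,
      show k + 1 + (m - k) = m + 1 by omega, nsmul_eq_mul]
    push_cast; ring
  rw [d2pow, Finset.sum_mul, Matrix.trace_sum]
  refine (norm_sum_le_of_le _ hk).trans (le_of_eq ?_)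
  rw [Finset.sum_const, Finset.card_range, nsmul_eq_mul]; ring

/-- A product of two first derivatives is a sum of `m n` monomials. -/
lemma norm_trace_dpow_mul_dpow_mul_le {A B Y Y' Q : Matrix (Fin d) (Fin d) ℂ} {m n : ℕ} {K : ℝ}
    (h : ∀ k j, k < m → j < n →
      ‖(A ^ (k + 1) * Y * (A ^ (m - k) * B ^ (j + 1)) * Y' * (B ^ (n - j) * Q)).trace‖ ≤ K) :
    ‖(dpow A Y m * dpow B Y' n * Q).trace‖ ≤ m * n * K := by
  have e : (dpow A Y m * dpow B Y' n * Q).trace = ∑ k ∈ Finset.range m, ∑ j ∈ Finset.range n,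
      (A ^ (k + 1) * Y * (A ^ (m - k) * B ^ (j + 1)) * Y' * (B ^ (n - j) * Q)).trace := by
    rw [dpow, dpow, Finset.sum_mul_sum, Finset.sum_mul, Matrix.trace_sum]
    refine Finset.sum_congr rfl fun k _ => ?_
    rw [Finset.sum_mul, Matrix.trace_sum]
    simp only [mul_assoc]
  rw [e]
  refine (norm_sum_le_of_le _ fun k hk => norm_sum_le_of_le _ fun j hj =>
    h k j (Finset.mem_range.mp hk) (Finset.mem_range.mp hj)).trans (le_of_eq ?_)
  simp only [Finset.sum_const, Finset.card_range, nsmul_eq_mul]; ring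

/-- The first derivative of `A ^ (p + 1) * A* ^ p` in direction `Y`, for a resolvent `A`. -/
def dprod (A Y : Matrix (Fin d) (Fin d) ℂ) (p : ℕ) : Matrix (Fin d) (Fin d) ℂ :=
  dpow A Y (p + 1) * Aᴴ ^ p + A ^ (p + 1) * dpow Aᴴ Y p

/-- The second derivative of `A ^ (p + 1) * A* ^ p` in directions `Y` and `Y'`. -/
def d2prod (A Y Y' : Matrix (Fin d) (Fin d) ℂ) (p : ℕ) : Matrix (Fin d) (Fin d) ℂ :=
  d2pow A Y Y' (p + 1) * Aᴴ ^ p + dpow A Y (p + 1) * dpow Aᴴ Y' p +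
    (dpow A Y' (p + 1) * dpow Aᴴ Y p + A ^ (p + 1) * d2pow Aᴴ Y Y' p)

/-- The bound on the third derivative of `Tr |z - X|^(-2p)` that drives the comparison: only one
of the three directions is paid for in operator norm. -/
lemma norm_trace_d2prod_mul_le {A Y₁ Y₂ Y₃ : Matrix (Fin d) (Fin d) ℂ} {r R : ℝ} {p : ℕ}
    (hp : 1 ≤ p) (hA : Commute A Aᴴ) (hr : ‖A‖ ≤ r)
    (hY₁ : Y₁.IsHermitian) (hY₂ : Y₂.IsHermitian) (hY₃ : Y₃.IsHermitian)
    (hR₁ : ‖Y₁‖ ≤ R) (hR₂ : ‖Y₂‖ ≤ R) (hR₃ : ‖Y₃‖ ≤ R) :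
    ‖(d2prod A Y₁ Y₂ p * Y₃).trace‖ ≤ 12 * p ^ 2 *
      (R * r ^ 3 * (hs (A ^ p * Y₁) ^ 2 + hs (A ^ p * Y₂) ^ 2 + hs (A ^ p * Y₃) ^ 2)) := by
  set K := R * r ^ 3 * (hs (A ^ p * Y₁) ^ 2 + hs (A ^ p * Y₂) ^ 2 + hs (A ^ p * Y₃) ^ 2) with hK
  have hr0 : 0 ≤ r := (norm_nonneg _).trans hr
  have hR0 : 0 ≤ R := (norm_nonneg _).trans hR₂
  have hK0 : 0 ≤ K := by positivity
  have hK' : K = R * r ^ 3 *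
      (hs (A ^ p * Y₂) ^ 2 + hs (A ^ p * Y₁) ^ 2 + hs (A ^ p * Y₃) ^ 2) := by rw [hK]; ring
  have t1 : ‖(d2pow A Y₁ Y₂ (p + 1) * (Aᴴ ^ p * Y₃)).trace‖ ≤
      ((p + 1 : ℕ) : ℝ) * ((p + 1 : ℕ) + 1) * K := by
    refine norm_trace_d2pow_mul_le (fun k j hk hj => ?_) (fun k j hk hj => ?_)
    · rw [hK']
      have := norm_trace_three_le (p := p) hA hr (isMonomial_pow A (j + 1))
        (isMonomial_pow A (k + 1 - j)) (isMonomial_pow_mul A (p + 1 - k) p) (by omega) (by omega)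
        (by omega) (by omega) hY₂ hY₁ hY₃ hR₂ hR₁ hR₃
      simpa only [mul_assoc] using this
    · rw [hK]
      have := norm_trace_three_le (p := p) hA hr (isMonomial_pow A (k + 1))
        (isMonomial_pow A (j + 1)) (isMonomial_pow_mul A (p + 1 - k - j) p) (by omega) (by omega)
        (by omega) (by omega) hY₁ hY₂ hY₃ hR₁ hR₂ hR₃
      simpa only [mul_assoc] using this
  have t2 : ‖(dpow A Y₁ (p + 1) * dpow Aᴴ Y₂ p * Y₃).trace‖ ≤ ((p + 1 : ℕ) : ℝ) * p * K := by
    refine norm_trace_dpow_mul_dpow_mul_le fun k j hk hj => ?_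
    rw [hK]
    have := norm_trace_three_le (p := p) hA hr (isMonomial_pow A (k + 1))
        (isMonomial_pow_mul A (p + 1 - k) (j + 1)) (isMonomial_conjTranspose_pow A (p - j))
        (by omega) (by omega) (by omega) (by omega) hY₁ hY₂ hY₃ hR₁ hR₂ hR₃
    simpa only [mul_assoc] using this
  have t3 : ‖(dpow A Y₂ (p + 1) * dpow Aᴴ Y₁ p * Y₃).trace‖ ≤ ((p + 1 : ℕ) : ℝ) * p * K := by
    refine norm_trace_dpow_mul_dpow_mul_le fun k j hk hj => ?_
    rw [hK']
    have := norm_trace_three_le (p := p) hA hr (isMonomial_pow A (k + 1))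
        (isMonomial_pow_mul A (p + 1 - k) (j + 1)) (isMonomial_conjTranspose_pow A (p - j))
        (by omega) (by omega) (by omega) (by omega) hY₂ hY₁ hY₃ hR₂ hR₁ hR₃
    simpa only [mul_assoc] using this
  have t4 : ‖(d2pow Aᴴ Y₁ Y₂ p * (Y₃ * A ^ (p + 1))).trace‖ ≤ (p : ℝ) * (p + 1) * K := by
    refine norm_trace_d2pow_mul_le (fun k j hk hj => ?_) (fun k j hk hj => ?_)
    · rw [hK']
      have := norm_trace_three_le (p := p) hA hr (isMonomial_pow_mul A (p + 1) (j + 1))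
        (isMonomial_conjTranspose_pow A (k + 1 - j)) (isMonomial_conjTranspose_pow A (p - k))
        (by omega) (by omega) (by omega) (by omega) hY₂ hY₁ hY₃ hR₂ hR₁ hR₃
      convert this using 2
      rw [← mul_assoc (Aᴴ ^ (p - k)), ← mul_assoc, Matrix.trace_mul_comm]
      simp only [mul_assoc]
    · have := norm_trace_three_le (p := p) hA hr (isMonomial_pow_mul A (p + 1) (k + 1))
        (isMonomial_conjTranspose_pow A (j + 1)) (isMonomial_conjTranspose_pow A (p - k - j))
        (by omega) (by omega) (by omega) (by omega) hY₁ hY₂ hY₃ hR₁ hR₂ hR₃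
      convert this using 2
      rw [← mul_assoc (Aᴴ ^ (p - k - j)), ← mul_assoc, Matrix.trace_mul_comm]
      simp only [mul_assoc]
  have e : (d2prod A Y₁ Y₂ p * Y₃).trace = (d2pow A Y₁ Y₂ (p + 1) * (Aᴴ ^ p * Y₃)).trace +
      (dpow A Y₁ (p + 1) * dpow Aᴴ Y₂ p * Y₃).trace +
      ((dpow A Y₂ (p + 1) * dpow Aᴴ Y₁ p * Y₃).trace +
        (d2pow Aᴴ Y₁ Y₂ p * (Y₃ * A ^ (p + 1))).trace) := by
    rw [d2prod, add_mul, add_mul, add_mul, Matrix.trace_add, Matrix.trace_add, Matrix.trace_add,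
      mul_assoc (d2pow A Y₁ Y₂ (p + 1)), mul_assoc (A ^ (p + 1)),
      Matrix.trace_mul_comm (A ^ (p + 1)), mul_assoc (d2pow Aᴴ Y₁ Y₂ p)]
  rw [e]
  have hp1 : (1 : ℝ) ≤ p := by exact_mod_cast hp
  push_cast at t1 t2 t3
  calc _ ≤ (p + 1) * (p + 1 + 1) * K + (p + 1) * p * K + ((p + 1) * p * K + p * (p + 1) * K) :=
        (norm_add_le _ _).trans (add_le_add ((norm_add_le _ _).trans (add_le_add t1 t2))
          ((norm_add_le _ _).trans (add_le_add t3 t4)))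
    _ = ((p + 1) * (4 * p + 2)) * K := by ring
    _ ≤ 12 * p ^ 2 * K := mul_le_mul_of_nonneg_right (by nlinarith) hK0

/-! ### The resolvent of a Hermitian matrix -/

/-- The resolvent `(z - X)⁻¹`. -/
def res (z : ℂ) (X : Matrix (Fin d) (Fin d) ℂ) : Matrix (Fin d) (Fin d) ℂ := (z • 1 - X)⁻¹

/-- The quadratic form of a Hermitian matrix is real, so that `z - X` is bounded below by `Im z`. -/
lemma im_mul_norm_le (z : ℂ) {X : Matrix (Fin d) (Fin d) ℂ} (hX : X.IsHermitian)
    (v : EuclideanSpace ℂ (Fin d)) :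
    z.im * ‖v‖ ≤ ‖Matrix.toEuclideanCLM (n := Fin d) (𝕜 := ℂ) (z • 1 - X) v‖ := by
  set T := Matrix.toEuclideanCLM (n := Fin d) (𝕜 := ℂ)
  have hsym : (inner ℂ v (T X v)).im = 0 := by
    have h1 : inner ℂ v (T X v) = inner ℂ (T X v) v := by
      have h2 : ContinuousLinearMap.adjoint (T X) = T X := by
        rw [← ContinuousLinearMap.star_eq_adjoint, ← map_star, Matrix.star_eq_conjTranspose, hX.eq]
      conv_rhs => rw [← h2, ContinuousLinearMap.adjoint_inner_left]
    have h3 := inner_conj_symm (𝕜 := ℂ) v (T X v)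
    rw [← h1] at h3
    exact Complex.conj_eq_iff_im.mp h3
  have him : (inner ℂ v (T (z • 1 - X) v)).im = z.im * ‖v‖ ^ 2 := by
    rw [map_sub, map_smul, map_one]
    simp only [sub_apply, smul_apply, one_apply_eq_self, inner_sub_right, inner_smul_right,
      Complex.sub_im, hsym, sub_zero]
    rw [inner_self_eq_norm_sq_to_K]
    change (z * ((‖v‖ : ℝ) : ℂ) ^ 2).im = z.im * ‖v‖ ^ 2
    rw [← Complex.ofReal_pow, Complex.im_mul_ofReal]
  have hle : z.im * ‖v‖ ^ 2 ≤ ‖v‖ * ‖T (z • 1 - X) v‖ := by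
    rw [← him]
    exact (Complex.im_le_norm _).trans (norm_inner_le_norm _ _)
  rcases eq_or_lt_of_le (norm_nonneg v) with h0 | h0
  · rw [← h0]; simp
  · nlinarith

lemma isUnit_sub {z : ℂ} {X : Matrix (Fin d) (Fin d) ℂ} (hX : X.IsHermitian) (hz : 0 < z.im) :
    IsUnit (z • 1 - X) := by
  rw [← Matrix.mulVec_injective_iff_isUnit]
  refine (injective_iff_map_eq_zero (Matrix.mulVecLin (z • 1 - X))).mpr fun v hv => ?_
  have h := im_mul_norm_le z hX (WithLp.toLp 2 v)
  have h0 : Matrix.toEuclideanCLM (n := Fin d) (𝕜 := ℂ) (z • 1 - X) (WithLp.toLp 2 v) = 0 := by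
    rw [Matrix.toEuclideanCLM_toLp]
    have : (z • 1 - X).mulVec v = 0 := hv
    rw [this]; rfl
  rw [h0, norm_zero] at h
  have h1 : ‖WithLp.toLp 2 v‖ = 0 :=
    le_antisymm (by nlinarith [norm_nonneg (WithLp.toLp 2 v)]) (norm_nonneg _)
  have h2 := norm_eq_zero.mp h1
  simpa using congrArg WithLp.ofLp h2

lemma sub_mul_res {z : ℂ} {X : Matrix (Fin d) (Fin d) ℂ} (hX : X.IsHermitian) (hz : 0 < z.im) :
    (z • 1 - X) * res z X = 1 :=
  Matrix.mul_nonsing_inv _ ((Matrix.isUnit_iff_isUnit_det _).mp (isUnit_sub hX hz))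

lemma res_mul_sub {z : ℂ} {X : Matrix (Fin d) (Fin d) ℂ} (hX : X.IsHermitian) (hz : 0 < z.im) :
    res z X * (z • 1 - X) = 1 :=
  Matrix.nonsing_inv_mul _ ((Matrix.isUnit_iff_isUnit_det _).mp (isUnit_sub hX hz))

lemma norm_res_le {z : ℂ} {X : Matrix (Fin d) (Fin d) ℂ} (hX : X.IsHermitian) (hz : 0 < z.im) :
    ‖res z X‖ ≤ z.im⁻¹ := by
  rw [Matrix.cstar_norm_def]
  refine ContinuousLinearMap.opNorm_le_bound _ (by positivity) fun v => ?_
  have h := im_mul_norm_le z hX (Matrix.toEuclideanCLM (n := Fin d) (𝕜 := ℂ) (res z X) v)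
  rw [← mul_apply_eq_comp, ← map_mul, sub_mul_res hX hz, map_one,
    one_apply_eq_self] at h
  rwa [inv_mul_eq_div, le_div_iff₀' hz]

lemma commute_res (z : ℂ) {X : Matrix (Fin d) (Fin d) ℂ} (hX : X.IsHermitian) :
    Commute (res z X) (res z X)ᴴ := by
  have hc : Commute (z • 1 - X) (z • 1 - X)ᴴ := by
    rw [Matrix.conjTranspose_sub, hX.eq, Matrix.conjTranspose_smul, Matrix.conjTranspose_one]
    exact ((Commute.one_left _).smul_left z |>.sub_left
      (((Commute.one_right X).smul_right _).sub_right (Commute.refl X)))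
  have h1 : res z X * (res z X)ᴴ = ((z • 1 - X)ᴴ * (z • 1 - X))⁻¹ := by
    rw [Matrix.mul_inv_rev, res, Matrix.conjTranspose_nonsing_inv]
  have h2 : (res z X)ᴴ * res z X = ((z • 1 - X) * (z • 1 - X)ᴴ)⁻¹ := by
    rw [Matrix.mul_inv_rev, res, Matrix.conjTranspose_nonsing_inv]
  rw [Commute, SemiconjBy, h1, h2, hc.eq]

lemma res_sub_res {z : ℂ} {X D : Matrix (Fin d) (Fin d) ℂ} (hX : X.IsHermitian)
    (hD : D.IsHermitian) (hz : 0 < z.im) :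
    res z (X + D) - res z X = res z (X + D) * D * res z X := by
  have h1 := res_mul_sub (hX.add hD) hz
  have h2 := sub_mul_res hX hz
  calc res z (X + D) - res z X
      = res z (X + D) * ((z • 1 - X) * res z X) - res z (X + D) * (z • 1 - (X + D)) * res z X := by
        rw [h1, h2, mul_one, one_mul]
    _ = _ := by noncomm_ring

/-! ### Differentiation along curves of Hermitian matrices -/

lemma hasDerivAt_res {z : ℂ} {X : ℝ → Matrix (Fin d) (Fin d) ℂ} {Y : Matrix (Fin d) (Fin d) ℂ}
    {s : ℝ} (hz : 0 < z.im) (hX : (X s).IsHermitian) (h : HasDerivAt X Y s) :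
    HasDerivAt (fun t => res z (X t)) (res z (X s) * Y * res z (X s)) s := by
  obtain ⟨u, hu⟩ := isUnit_sub hX hz
  have h1 := hasFDerivAt_ringInverse (𝕜 := ℝ) u
  rw [hu] at h1
  have h2 := h1.comp_hasDerivAt s (h.const_sub (z • 1))
  have e : (fun t => res z (X t)) = Ring.inverse ∘ fun t => z • 1 - X t := by
    funext t
    simp [res, Matrix.nonsing_inv_eq_ringInverse]
  rw [e]
  refine h2.congr_deriv ?_
  have hu' : (↑u⁻¹ : Matrix (Fin d) (Fin d) ℂ) = res z (X s) := by
    rw [res, ← hu, Matrix.coe_units_inv]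
  simp [hu']

lemma hasDerivAt_conjTranspose {F : ℝ → Matrix (Fin d) (Fin d) ℂ}
    {F' : Matrix (Fin d) (Fin d) ℂ} {s : ℝ} (h : HasDerivAt F F' s) :
    HasDerivAt (fun t => (F t)ᴴ) F'ᴴ s :=
  h.star

/-- If `U` solves `U' = U Y U`, as a resolvent does along a curve with velocity `Y`, then the
derivative of `U ^ m` is `dpow U Y m`. -/
lemma hasDerivAt_pow_of_riccati {U : ℝ → Matrix (Fin d) (Fin d) ℂ} {Y : Matrix (Fin d) (Fin d) ℂ}
    {s : ℝ} (h : HasDerivAt U (U s * Y * U s) s) (m : ℕ) :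
    HasDerivAt (fun t => U t ^ m) (dpow (U s) Y m) s := by
  induction m with
  | zero => simpa [dpow] using hasDerivAt_const s (1 : Matrix (Fin d) (Fin d) ℂ)
  | succ m ih =>
    simp only [pow_succ' _ m]
    refine (h.mul ih).congr_deriv ?_
    rw [dpow_succ, add_comm, pow_succ' _ m]
    simp only [mul_assoc]

lemma hasDerivAt_dpow {U : ℝ → Matrix (Fin d) (Fin d) ℂ} {Y : Matrix (Fin d) (Fin d) ℂ}
    {s : ℝ} (h : HasDerivAt U (U s * Y * U s) s) (Y' : Matrix (Fin d) (Fin d) ℂ) (m : ℕ) :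
    HasDerivAt (fun t => dpow (U t) Y' m) (d2pow (U s) Y' Y m) s := by
  unfold dpow d2pow
  refine HasDerivAt.fun_sum fun k _ => ?_
  exact ((hasDerivAt_pow_of_riccati h (k + 1)).mul_const Y').mul
    (hasDerivAt_pow_of_riccati h (m - k))

/-- The real part of the trace, as a real continuous linear map. -/
def reTrace : Matrix (Fin d) (Fin d) ℂ →L[ℝ] ℝ :=
  LinearMap.toContinuousLinearMap (Complex.reLm ∘ₗ Matrix.traceLinearMap (Fin d) ℝ ℂ)

lemma reTrace_apply (M : Matrix (Fin d) (Fin d) ℂ) : reTrace M = M.trace.re := rfl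

lemma hasDerivAt_reTrace {F : ℝ → Matrix (Fin d) (Fin d) ℂ}
    {F' : Matrix (Fin d) (Fin d) ℂ} {s : ℝ} (h : HasDerivAt F F' s) :
    HasDerivAt (fun t => (F t).trace.re) F'.trace.re s :=
  reTrace.hasFDerivAt.comp_hasDerivAt s h

/-- `Tr |z - X|^(-2p)` for Hermitian `X`. -/
def powTrace (z : ℂ) (p : ℕ) (X : Matrix (Fin d) (Fin d) ℂ) : ℝ :=
  (res z X ^ p * (res z X)ᴴ ^ p).trace.re

/-- The derivative of `powTrace` at a Hermitian matrix `X` in a Hermitian direction `Y`. -/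
def powTraceD1 (z : ℂ) (p : ℕ) (X Y : Matrix (Fin d) (Fin d) ℂ) : ℝ :=
  2 * p * (res z X ^ (p + 1) * (res z X)ᴴ ^ p * Y).trace.re

/-- The second derivative of `powTrace` at `X` in Hermitian directions `Y` and `Y'`. -/
def powTraceD2 (z : ℂ) (p : ℕ) (X Y Y' : Matrix (Fin d) (Fin d) ℂ) : ℝ :=
  2 * p * (dprod (res z X) Y p * Y').trace.re

/-- The third derivative of `powTrace` at `X` in Hermitian directions `Y`, `Y'` and `Y''`. -/
def powTraceD3 (z : ℂ) (p : ℕ) (X Y Y' Y'' : Matrix (Fin d) (Fin d) ℂ) : ℝ :=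
  2 * p * (d2prod (res z X) Y Y' p * Y'').trace.re

section Derivatives

variable {z : ℂ} {p : ℕ} {X : ℝ → Matrix (Fin d) (Fin d) ℂ} {Y : Matrix (Fin d) (Fin d) ℂ} {s : ℝ}

lemma hasDerivAt_res_conjTranspose (hz : 0 < z.im) (hX : (X s).IsHermitian) (hY : Y.IsHermitian)
    (h : HasDerivAt X Y s) :
    HasDerivAt (fun t => (res z (X t))ᴴ) ((res z (X s))ᴴ * Y * (res z (X s))ᴴ) s := by
  convert hasDerivAt_conjTranspose (hasDerivAt_res hz hX h) using 1
  simp only [Matrix.conjTranspose_mul, hY.eq, mul_assoc]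

/-- Under a trace, all the terms of `dpow` next to a commuting factor coincide. -/
lemma trace_dpow_mul {A B Y : Matrix (Fin d) (Fin d) ℂ} (h : Commute A B) (m n : ℕ) :
    (dpow A Y m * B ^ n).trace = m * (A ^ (m + 1) * B ^ n * Y).trace := by
  rw [dpow, Finset.sum_mul, Matrix.trace_sum, ← nsmul_eq_mul]
  rw [Finset.sum_congr rfl (g := fun _ => (A ^ (m + 1) * B ^ n * Y).trace), Finset.sum_const,
    Finset.card_range]
  intro k hk
  have hk' := Finset.mem_range.mp hk
  have hc : Commute (A ^ (k + 1)) (B ^ n) := h.pow_pow _ _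
  rw [mul_assoc, Matrix.trace_mul_comm, show m + 1 = (m - k) + (k + 1) by omega,
    pow_add A (m - k), mul_assoc (A ^ (m - k)) (A ^ (k + 1)), hc.eq]
  simp only [mul_assoc]

lemma hasDerivAt_powTrace (hz : 0 < z.im) (hX : (X s).IsHermitian) (hY : Y.IsHermitian)
    (h : HasDerivAt X Y s) :
    HasDerivAt (fun t => powTrace z p (X t)) (powTraceD1 z p (X s) Y) s := by
  have hA := commute_res z hX
  have h1 := hasDerivAt_pow_of_riccati (hasDerivAt_res hz hX h) p
  have h2 := hasDerivAt_pow_of_riccati (hasDerivAt_res_conjTranspose hz hX hY h) p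
  refine (hasDerivAt_reTrace (h1.mul h2)).congr_deriv ?_
  set A := res z (X s)
  have e1 : (dpow A Y p * Aᴴ ^ p).trace = p * (A ^ (p + 1) * Aᴴ ^ p * Y).trace :=
    trace_dpow_mul hA p p
  have e2 : (A ^ p * dpow Aᴴ Y p).trace = star (dpow A Y p * Aᴴ ^ p).trace := by
    rw [← Matrix.trace_conjTranspose, Matrix.conjTranspose_mul, dpow_conjTranspose _ _ hY,
      ← Matrix.conjTranspose_pow, Matrix.conjTranspose_conjTranspose]
  rw [Matrix.trace_add, e2, Complex.add_re, Complex.star_def, Complex.conj_re, e1, powTraceD1]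
  simp [Complex.mul_re]
  ring

lemma hasDerivAt_powTraceD1 (hz : 0 < z.im) (hX : (X s).IsHermitian) (hY : Y.IsHermitian)
    (h : HasDerivAt X Y s) (Y' : Matrix (Fin d) (Fin d) ℂ) :
    HasDerivAt (fun t => powTraceD1 z p (X t) Y') (powTraceD2 z p (X s) Y Y') s := by
  have h1 := hasDerivAt_pow_of_riccati (hasDerivAt_res hz hX h) (p + 1)
  have h2 := hasDerivAt_pow_of_riccati (hasDerivAt_res_conjTranspose hz hX hY h) p
  exact (hasDerivAt_reTrace ((h1.mul h2).mul_const Y')).const_mul _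

lemma hasDerivAt_powTraceD2 (hz : 0 < z.im) (hX : (X s).IsHermitian) (hY : Y.IsHermitian)
    (h : HasDerivAt X Y s) (Y' Y'' : Matrix (Fin d) (Fin d) ℂ) :
    HasDerivAt (fun t => powTraceD2 z p (X t) Y' Y'') (powTraceD3 z p (X s) Y' Y Y'') s := by
  have hr := hasDerivAt_res hz hX h
  have hr' := hasDerivAt_res_conjTranspose hz hX hY h
  have h1 := (hasDerivAt_dpow hr Y' (p + 1)).mul (hasDerivAt_pow_of_riccati hr' p)
  have h2 := (hasDerivAt_pow_of_riccati hr (p + 1)).mul (hasDerivAt_dpow hr' Y' p)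
  exact (hasDerivAt_reTrace ((h1.add h2).mul_const Y'')).const_mul _

end Derivatives

/-! ### Bounds on the derivatives -/

lemma hs_one_sq : hs (1 : Matrix (Fin d) (Fin d) ℂ) ^ 2 = d := by
  rw [hs_sq_eq_trace]; simp

lemma hs_le_norm (M : Matrix (Fin d) (Fin d) ℂ) :
    hs M ≤ ‖M‖ * hs (1 : Matrix (Fin d) (Fin d) ℂ) := by
  simpa using hs_mul_le M 1

lemma norm_trace_le (M : Matrix (Fin d) (Fin d) ℂ) : ‖M.trace‖ ≤ d * ‖M‖ := by
  have h := norm_trace_mul_le M 1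
  rw [mul_one] at h
  calc _ ≤ _ := h
    _ ≤ ‖M‖ * hs (1 : Matrix (Fin d) (Fin d) ℂ) * hs (1 : Matrix (Fin d) (Fin d) ℂ) :=
      mul_le_mul_of_nonneg_right (hs_le_norm M) (hs_nonneg _)
    _ = d * ‖M‖ := by rw [← hs_one_sq (d := d)]; ring

lemma norm_dpow_le [NeZero d] (A Y : Matrix (Fin d) (Fin d) ℂ) (m : ℕ) :
    ‖dpow A Y m‖ ≤ m * ‖A‖ ^ (m + 1) * ‖Y‖ := by
  refine (norm_sum_le_of_le (n := fun _ => ‖A‖ ^ (m + 1) * ‖Y‖) _ fun k hk => ?_).trans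
    (le_of_eq ?_)
  · have hk' := Finset.mem_range.mp hk
    calc _ ≤ ‖A‖ ^ (k + 1) * ‖Y‖ * ‖A‖ ^ (m - k) :=
          norm_mul_le_of_le (norm_mul_le_of_le (norm_pow_le _ _) le_rfl) (norm_pow_le _ _)
      _ = _ := by
        rw [show m + 1 = (k + 1) + (m - k) by omega, pow_add]; ring
  · rw [Finset.sum_const, Finset.card_range, nsmul_eq_mul]; ring

section Estimates

variable {z : ℂ} {p : ℕ} {X : Matrix (Fin d) (Fin d) ℂ}

lemma norm_res_pow_le [NeZero d] (hX : X.IsHermitian) (hz : 0 < z.im) (m : ℕ) :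
    ‖res z X ^ m‖ ≤ z.im⁻¹ ^ m :=
  (norm_pow_le _ _).trans (pow_le_pow_left₀ (norm_nonneg _) (norm_res_le hX hz) _)

lemma norm_res_conjTranspose_pow_le [NeZero d] (hX : X.IsHermitian) (hz : 0 < z.im) (m : ℕ) :
    ‖(res z X)ᴴ ^ m‖ ≤ z.im⁻¹ ^ m := by
  refine (norm_pow_le _ _).trans (pow_le_pow_left₀ (norm_nonneg _) ?_ _)
  rw [Matrix.l2_opNorm_conjTranspose]; exact norm_res_le hX hz

lemma powTrace_eq_hs_sq (hX : X.IsHermitian) : powTrace z p X = hs (res z X ^ p) ^ 2 := by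
  rw [hs_sq_eq_trace, powTrace, Matrix.conjTranspose_pow, ((commute_res z hX).pow_pow p p).eq]

lemma powTrace_nonneg (hX : X.IsHermitian) : 0 ≤ powTrace z p X := by
  rw [powTrace_eq_hs_sq hX]; positivity

lemma powTrace_le [NeZero d] (hX : X.IsHermitian) (hz : 0 < z.im) :
    powTrace z p X ≤ d * z.im⁻¹ ^ (2 * p) := by
  refine (Complex.re_le_norm _).trans ((norm_trace_le _).trans ?_)
  gcongr
  rw [two_mul, pow_add]
  exact norm_mul_le_of_le (norm_res_pow_le hX hz p) (norm_res_conjTranspose_pow_le hX hz p)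

lemma powTrace_pos [NeZero d] (hX : X.IsHermitian) (hz : 0 < z.im) : 0 < powTrace z p X := by
  rw [powTrace_eq_hs_sq hX]
  have hne : res z X ^ p ≠ 0 := by
    have h := (isUnit_sub hX hz).pow p
    intro h0
    have h1 : (res z X * (z • 1 - X)) ^ p = 1 := by rw [res_mul_sub hX hz, one_pow]
    have hc : Commute (res z X) (z • 1 - X) := by
      rw [Commute, SemiconjBy, res_mul_sub hX hz, sub_mul_res hX hz]
    rw [hc.mul_pow, h0, zero_mul] at h1
    exact zero_ne_one h1
  have : 0 < hs (res z X ^ p) := by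
    refine norm_pos_iff.mpr fun h => hne ?_
    ext i j
    exact congrFun (congrArg WithLp.ofLp h) (i, j)
  positivity

lemma abs_powTraceD1_le [NeZero d] (hX : X.IsHermitian) (hz : 0 < z.im)
    (Y : Matrix (Fin d) (Fin d) ℂ) :
    |powTraceD1 z p X Y| ≤ 2 * p * d * z.im⁻¹ ^ (2 * p + 1) * ‖Y‖ := by
  rw [powTraceD1, abs_mul, abs_of_nonneg (by positivity : (0 : ℝ) ≤ 2 * p)]
  have h : |(res z X ^ (p + 1) * (res z X)ᴴ ^ p * Y).trace.re| ≤
      d * (z.im⁻¹ ^ (p + 1) * z.im⁻¹ ^ p * ‖Y‖) := by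
    refine (Complex.abs_re_le_norm _).trans ((norm_trace_le _).trans ?_)
    gcongr
    exact norm_mul_le_of_le (norm_mul_le_of_le (norm_res_pow_le hX hz _)
      (norm_res_conjTranspose_pow_le hX hz _)) le_rfl
  calc _ ≤ 2 * p * (d * (z.im⁻¹ ^ (p + 1) * z.im⁻¹ ^ p * ‖Y‖)) := by gcongr
    _ = _ := by rw [← pow_add, show p + 1 + p = 2 * p + 1 by ring]; ring

lemma abs_powTraceD2_le [NeZero d] (hX : X.IsHermitian) (hz : 0 < z.im)
    (Y Y' : Matrix (Fin d) (Fin d) ℂ) :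
    |powTraceD2 z p X Y Y'| ≤
      2 * p * d * (2 * p + 1) * z.im⁻¹ ^ (2 * p + 2) * (‖Y‖ * ‖Y'‖) := by
  have hA := norm_res_le hX hz
  have hA' : ‖(res z X)ᴴ‖ ≤ z.im⁻¹ := by rwa [Matrix.l2_opNorm_conjTranspose]
  have h1 : ‖dpow (res z X) Y (p + 1)‖ ≤ ((p + 1 : ℕ) : ℝ) * z.im⁻¹ ^ (p + 2) * ‖Y‖ :=
    (norm_dpow_le _ _ _).trans (by gcongr)
  have h2 : ‖dpow (res z X)ᴴ Y p‖ ≤ p * z.im⁻¹ ^ (p + 1) * ‖Y‖ :=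
    (norm_dpow_le _ _ _).trans (by gcongr)
  rw [powTraceD2, abs_mul, abs_of_nonneg (by positivity : (0 : ℝ) ≤ 2 * p)]
  have h : |(dprod (res z X) Y p * Y').trace.re| ≤
      d * ((((p + 1 : ℕ) : ℝ) * z.im⁻¹ ^ (p + 2) * ‖Y‖ * z.im⁻¹ ^ p +
        z.im⁻¹ ^ (p + 1) * (p * z.im⁻¹ ^ (p + 1) * ‖Y‖)) * ‖Y'‖) := by
    refine (Complex.abs_re_le_norm _).trans ((norm_trace_le _).trans ?_)
    gcongr
    refine norm_mul_le_of_le ?_ le_rfl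
    exact norm_add_le_of_le (norm_mul_le_of_le h1 (norm_res_conjTranspose_pow_le hX hz _))
      (norm_mul_le_of_le (norm_res_pow_le hX hz _) h2)
  calc _ ≤ _ := mul_le_mul_of_nonneg_left h (by positivity)
    _ = _ := by push_cast; ring

/-- The bound on the third derivative, with two of the directions measured in the norm
`‖(z - X)^(-p) Y‖` in which the variance parameter acts. -/
lemma abs_powTraceD3_le {R : ℝ} (hp : 1 ≤ p) (hX : X.IsHermitian) (hz : 0 < z.im)
    {Y₁ Y₂ Y₃ : Matrix (Fin d) (Fin d) ℂ}
    (hY₁ : Y₁.IsHermitian) (hY₂ : Y₂.IsHermitian) (hY₃ : Y₃.IsHermitian)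
    (hR₁ : ‖Y₁‖ ≤ R) (hR₂ : ‖Y₂‖ ≤ R) (hR₃ : ‖Y₃‖ ≤ R) :
    |powTraceD3 z p X Y₁ Y₂ Y₃| ≤ 24 * p ^ 3 * R * z.im⁻¹ ^ 3 *
      (hs (res z X ^ p * Y₁) ^ 2 + hs (res z X ^ p * Y₂) ^ 2 + hs (res z X ^ p * Y₃) ^ 2) := by
  rw [powTraceD3, abs_mul, abs_of_nonneg (by positivity : (0 : ℝ) ≤ 2 * p)]
  calc _ ≤ 2 * (p : ℝ) * (12 * p ^ 2 * (R * z.im⁻¹ ^ 3 * (hs (res z X ^ p * Y₁) ^ 2 +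
        hs (res z X ^ p * Y₂) ^ 2 + hs (res z X ^ p * Y₃) ^ 2))) := by
        gcongr
        exact (Complex.abs_re_le_norm _).trans (norm_trace_d2prod_mul_le hp (commute_res z hX)
          (norm_res_le hX hz) hY₁ hY₂ hY₃ hR₁ hR₂ hR₃)
    _ = _ := by ring

/-! ### Comparison of nearby resolvents -/

lemma isHermitian_smul_real {Y : Matrix (Fin d) (Fin d) ℂ} (hY : Y.IsHermitian) (t : ℝ) :
    (t • Y).IsHermitian := by
  rw [Matrix.IsHermitian, Matrix.conjTranspose_smul, hY.eq, star_trivial]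

variable {Y Y' : Matrix (Fin d) (Fin d) ℂ} {R t : ℝ}

/-- Comparison of the resolvents at `X` and `X + t Y`, tested on a matrix `Y'`. The condition on
`p R / Im z` makes the perturbation small. -/
lemma hs_res_add_pow_mul_le (hX : X.IsHermitian) (hY : Y.IsHermitian) (hz : 0 < z.im)
    (hRY : ‖Y‖ ≤ R) (hRY' : ‖Y'‖ ≤ R) (hε : p * R * z.im⁻¹ ≤ 1 / 6) (ht : |t| ≤ 1) :
    hs (res z (X + t • Y) ^ p * Y') ≤ hs (res z X ^ p * Y') + 1 / 6 *
      (hs (res z (X + t • Y) ^ p * Y) + hs (res z X ^ p * Y)) ∧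
    hs (res z X ^ p * Y') ≤ hs (res z (X + t • Y) ^ p * Y') + 1 / 6 *
      (hs (res z (X + t • Y) ^ p * Y) + hs (res z X ^ p * Y)) := by
  have hR0 : 0 ≤ R := (norm_nonneg _).trans hRY
  have hD := isHermitian_smul_real hY t
  have hXD := hX.add hD
  have a0 := hs_nonneg (res z X ^ p * Y)
  have a1 := hs_nonneg (res z (X + t • Y) ^ p * Y)
  have key : p * R * z.im⁻¹ * (|t| * hs (res z (X + t • Y) ^ p * Y) +
      |t| * hs (res z X ^ p * Y)) ≤
      1 / 6 * (hs (res z (X + t • Y) ^ p * Y) + hs (res z X ^ p * Y)) := by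
    refine mul_le_mul hε ?_ (by positivity) (by norm_num)
    exact add_le_add (mul_le_of_le_one_left a1 ht) (mul_le_of_le_one_left a0 ht)
  constructor
  · have h := hs_pow_mul_le_add (commute_res z hX) (commute_res z hXD) (norm_res_le hX hz) hD hRY'
      (res_sub_res hX hD hz) p
    rw [mul_smul_comm, mul_smul_comm, hs_smul, hs_smul] at h
    exact h.trans (add_le_add le_rfl key)
  · have e : res z X - res z (X + t • Y) = res z X * -(t • Y) * res z (X + t • Y) := by
      have := res_sub_res hXD hD.neg hz
      rwa [add_neg_cancel_right] at this
    have h := hs_pow_mul_le_add (commute_res z hXD) (commute_res z hX) (norm_res_le hXD hz)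
      hD.neg hRY' e p
    rw [mul_neg, mul_neg, hs_neg, hs_neg, mul_smul_comm, mul_smul_comm, hs_smul, hs_smul,
      add_comm (|t| * _)] at h
    exact h.trans (add_le_add le_rfl key)

/-- Tested on the perturbation `Y` itself, the comparison closes up. -/
lemma hs_res_add_pow_mul_self_le (hX : X.IsHermitian) (hY : Y.IsHermitian) (hz : 0 < z.im)
    (hRY : ‖Y‖ ≤ R) (hε : p * R * z.im⁻¹ ≤ 1 / 6) (ht : |t| ≤ 1) :
    hs (res z (X + t • Y) ^ p * Y) ≤ 2 * hs (res z X ^ p * Y) := by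
  have h := (hs_res_add_pow_mul_le hX hY hz hRY hRY hε ht).1
  have a0 := hs_nonneg (res z X ^ p * Y)
  linarith

lemma hs_res_add_pow_mul_sq_le (hX : X.IsHermitian) (hY : Y.IsHermitian) (hz : 0 < z.im)
    (hRY : ‖Y‖ ≤ R) (hRY' : ‖Y'‖ ≤ R) (hε : p * R * z.im⁻¹ ≤ 1 / 6) (ht : |t| ≤ 1) :
    hs (res z (X + t • Y) ^ p * Y') ^ 2 ≤
      2 * hs (res z X ^ p * Y') ^ 2 + hs (res z X ^ p * Y) ^ 2 / 2 ∧
    hs (res z X ^ p * Y') ^ 2 ≤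
      2 * hs (res z (X + t • Y) ^ p * Y') ^ 2 + hs (res z X ^ p * Y) ^ 2 / 2 := by
  obtain ⟨h1, h2⟩ := hs_res_add_pow_mul_le hX hY hz hRY hRY' hε ht
  have h3 := hs_res_add_pow_mul_self_le hX hY hz hRY hε ht
  set a := hs (res z X ^ p * Y)
  set b := hs (res z X ^ p * Y')
  set c := hs (res z (X + t • Y) ^ p * Y')
  have hb : 0 ≤ b := hs_nonneg _
  have hc : 0 ≤ c := hs_nonneg _
  have ha : 0 ≤ a := hs_nonneg _
  have h1' : c ≤ b + a / 2 := by linarith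
  have h2' : b ≤ c + a / 2 := by linarith
  constructor
  · nlinarith [sq_nonneg (b - a / 2), pow_le_pow_left₀ hc h1' 2]
  · nlinarith [sq_nonneg (c - a / 2), pow_le_pow_left₀ hb h2' 2]

/-! ### Taylor expansion along a bounded perturbation -/

lemma hasDerivAt_line (X Y : Matrix (Fin d) (Fin d) ℂ) (u : ℝ) :
    HasDerivAt (fun t : ℝ => X + t • Y) Y u := by
  simpa using ((hasDerivAt_id u).smul_const Y).const_add X

lemma abs_image_sub_le_of_abs_deriv_le {h h' : ℝ → ℝ} {M : ℝ}
    (hd : ∀ u, HasDerivAt h (h' u) u) (hM : ∀ u, |u| ≤ 1 → |h' u| ≤ M) (ht : |t| ≤ 1) :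
    |h t - h 0| ≤ M * |t| := by
  have := (convex_Icc (-1 : ℝ) 1).norm_image_sub_le_of_norm_hasDerivWithin_le (f := h) (f' := h')
    (C := M) (x := 0) (y := t) (fun u _ => (hd u).hasDerivWithinAt)
    (fun u hu => hM u (abs_le.mpr hu)) (Set.mem_Icc.mpr (by norm_num)) (abs_le.mp ht)
  simpa using this

/-- Taylor expansion to second order of the derivative of `powTrace` along its own direction. The
remainder is expressed through the resolvent at the base point `X`. -/
lemma abs_powTraceD1_sub_sub_le (hp : 1 ≤ p) (hX : X.IsHermitian) (hY : Y.IsHermitian)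
    (hz : 0 < z.im) (hRY : ‖Y‖ ≤ R) (hε : p * R * z.im⁻¹ ≤ 1 / 6) (ht : |t| ≤ 1) :
    |powTraceD1 z p (X + t • Y) Y - powTraceD1 z p X Y - t * powTraceD2 z p X Y Y| ≤
      288 * p ^ 3 * R * z.im⁻¹ ^ 3 * hs (res z X ^ p * Y) ^ 2 := by
  have hR0 : 0 ≤ R := (norm_nonneg _).trans hRY
  have hline : ∀ u : ℝ, (X + u • Y).IsHermitian := fun u => hX.add (isHermitian_smul_real hY u)
  set M := 288 * p ^ 3 * R * z.im⁻¹ ^ 3 * hs (res z X ^ p * Y) ^ 2 with hM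
  have hM0 : 0 ≤ M := by positivity
  have b3 : ∀ u : ℝ, |u| ≤ 1 → |powTraceD3 z p (X + u • Y) Y Y Y| ≤ M := by
    intro u hu
    refine (abs_powTraceD3_le hp (hline u) hz hY hY hY hRY hRY hRY).trans ?_
    have h := pow_le_pow_left₀ (hs_nonneg _) (hs_res_add_pow_mul_self_le hX hY hz hRY hε hu) 2
    calc _ ≤ 24 * p ^ 3 * R * z.im⁻¹ ^ 3 * ((2 * hs (res z X ^ p * Y)) ^ 2 +
          (2 * hs (res z X ^ p * Y)) ^ 2 + (2 * hs (res z X ^ p * Y)) ^ 2) := by gcongr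
      _ = M := by rw [hM]; ring
  have b2 : ∀ u : ℝ, |u| ≤ 1 →
      |powTraceD2 z p (X + u • Y) Y Y - powTraceD2 z p X Y Y| ≤ M := by
    intro u hu
    have := abs_image_sub_le_of_abs_deriv_le (h := fun u => powTraceD2 z p (X + u • Y) Y Y)
      (fun u => hasDerivAt_powTraceD2 hz (hline u) hY (hasDerivAt_line X Y u) Y Y) b3 hu
    simp only [zero_smul, add_zero] at this
    exact this.trans (mul_le_of_le_one_right hM0 hu)
  have := abs_image_sub_le_of_abs_deriv_le (M := M) (t := t)
    (h := fun u => powTraceD1 z p (X + u • Y) Y - u * powTraceD2 z p X Y Y)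
    (fun u => (hasDerivAt_powTraceD1 hz (hline u) hY (hasDerivAt_line X Y u) Y).sub
      ((hasDerivAt_id u).mul_const (powTraceD2 z p X Y Y))) ?_ ht
  · simp only [zero_smul, add_zero, zero_mul, sub_zero] at this
    rw [sub_right_comm]
    exact this.trans (mul_le_of_le_one_right hM0 ht)
  · intro u hu
    rw [one_mul]
    exact b2 u hu

/-- The second derivative of `powTrace` in a direction `Y'` changes little along `Y`. -/
lemma abs_powTraceD2_sub_le (hp : 1 ≤ p) (hX : X.IsHermitian) (hY : Y.IsHermitian)
    (hY' : Y'.IsHermitian) (hz : 0 < z.im) (hRY : ‖Y‖ ≤ R) (hRY' : ‖Y'‖ ≤ R)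
    (hε : p * R * z.im⁻¹ ≤ 1 / 6) (ht : |t| ≤ 1) :
    |powTraceD2 z p (X + t • Y) Y' Y' - powTraceD2 z p X Y' Y'| ≤
      24 * p ^ 3 * R * z.im⁻¹ ^ 3 *
        (5 * hs (res z X ^ p * Y) ^ 2 + 4 * hs (res z X ^ p * Y') ^ 2) := by
  have hR0 : 0 ≤ R := (norm_nonneg _).trans hRY
  have hline : ∀ u : ℝ, (X + u • Y).IsHermitian := fun u => hX.add (isHermitian_smul_real hY u)
  set M := 24 * p ^ 3 * R * z.im⁻¹ ^ 3 *
    (5 * hs (res z X ^ p * Y) ^ 2 + 4 * hs (res z X ^ p * Y') ^ 2) with hM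
  have hM0 : 0 ≤ M := by positivity
  have b3 : ∀ u : ℝ, |u| ≤ 1 → |powTraceD3 z p (X + u • Y) Y' Y Y'| ≤ M := by
    intro u hu
    refine (abs_powTraceD3_le hp (hline u) hz hY' hY hY' hRY' hRY hRY').trans ?_
    have h1 := pow_le_pow_left₀ (hs_nonneg _) (hs_res_add_pow_mul_self_le hX hY hz hRY hε hu) 2
    have h2 := (hs_res_add_pow_mul_sq_le hX hY hz hRY hRY' hε hu).1
    rw [hM]
    refine mul_le_mul_of_nonneg_left ?_ (by positivity)
    linarith
  have := abs_image_sub_le_of_abs_deriv_le (h := fun u => powTraceD2 z p (X + u • Y) Y' Y')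
    (fun u => hasDerivAt_powTraceD2 hz (hline u) hY (hasDerivAt_line X Y u) Y' Y') b3 ht
  simp only [zero_smul, add_zero] at this
  exact this.trans (mul_le_of_le_one_right hM0 ht)

end Estimates

/-! ### Measurability -/

/-- The product σ-algebra of the entries. -/
instance matrixMeasurableSpace : MeasurableSpace (Matrix (Fin d) (Fin d) ℂ) :=
  inferInstanceAs (MeasurableSpace (Fin d → Fin d → ℂ))

/-- The operator norm induces the product topology of the entries. -/
instance matrixBorelSpace : BorelSpace (Matrix (Fin d) (Fin d) ℂ) :=
  inferInstanceAs (BorelSpace (Fin d → Fin d → ℂ))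

instance matrixSecondCountable : SecondCountableTopology (Matrix (Fin d) (Fin d) ℂ) :=
  inferInstanceAs (SecondCountableTopology (Fin d → Fin d → ℂ))

lemma measurable_of_entry {T : Type*} [MeasurableSpace T] {F : T → Matrix (Fin d) (Fin d) ℂ}
    (h : ∀ a b, Measurable fun ω => F ω a b) : Measurable F :=
  measurable_pi_iff.mpr fun a => measurable_pi_iff.mpr fun b => h a b

lemma measurable_res (z : ℂ) : Measurable (res (d := d) z) := by
  have h : res (d := d) z = fun X => ((z • 1 - X).det)⁻¹ • (z • 1 - X).adjugate := by
    funext X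
    rw [res, Matrix.inv_def, Ring.inverse_eq_inv']
  have hc : Continuous fun X : Matrix (Fin d) (Fin d) ℂ => z • 1 - X := by fun_prop
  rw [h]
  exact (hc.matrix_det.measurable.inv).smul hc.matrix_adjugate.measurable

section Measurability

variable {T : Type*} [MeasurableSpace T] {X Y Y' : T → Matrix (Fin d) (Fin d) ℂ}

lemma measurable_conjTranspose (hX : Measurable X) : Measurable fun ω => (X ω)ᴴ := by
  have h : Continuous fun M : Matrix (Fin d) (Fin d) ℂ => Mᴴ := by fun_prop
  exact h.measurable.comp hX

lemma measurable_trace_re (hX : Measurable X) : Measurable fun ω => (X ω).trace.re :=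
  reTrace.measurable.comp hX

lemma measurable_dpow (hX : Measurable X) (hY : Measurable Y) (m : ℕ) :
    Measurable fun ω => dpow (X ω) (Y ω) m := by
  unfold dpow
  fun_prop

lemma measurable_powTrace (z : ℂ) (p : ℕ) (hX : Measurable X) :
    Measurable fun ω => powTrace z p (X ω) := by
  have hA := (measurable_res z).comp hX
  exact measurable_trace_re ((hA.pow_const p).mul ((measurable_conjTranspose hA).pow_const p))

lemma measurable_powTraceD1 (z : ℂ) (p : ℕ) (hX : Measurable X) (hY : Measurable Y) :
    Measurable fun ω => powTraceD1 z p (X ω) (Y ω) := by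
  have hA := (measurable_res z).comp hX
  exact (measurable_trace_re (((hA.pow_const (p + 1)).mul
    ((measurable_conjTranspose hA).pow_const p)).mul hY)).const_mul _

lemma measurable_powTraceD2 (z : ℂ) (p : ℕ) (hX : Measurable X) (hY : Measurable Y)
    (hY' : Measurable Y') : Measurable fun ω => powTraceD2 z p (X ω) (Y ω) (Y' ω) := by
  have hA := (measurable_res z).comp hX
  have hA' := measurable_conjTranspose hA
  exact (measurable_trace_re ((((measurable_dpow hA hY (p + 1)).mul (hA'.pow_const p)).add
    ((hA.pow_const (p + 1)).mul (measurable_dpow hA' hY p))).mul hY')).const_mul _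

lemma measurable_hs_res_pow_mul_sq (z : ℂ) (p : ℕ) (hX : Measurable X) (hY : Measurable Y) :
    Measurable fun ω => hs (res z (X ω) ^ p * Y ω) ^ 2 := by
  have hA := (((measurable_res z).comp hX).pow_const p).mul hY
  simp only [hs_sq_eq_trace]
  exact measurable_trace_re ((measurable_conjTranspose hA).mul hA)

/-! ### One summand -/

section Integrability

variable [NeZero d] {μ : Measure T} {z : ℂ} {p : ℕ} {R : ℝ}

lemma integrable_powTrace [IsProbabilityMeasure μ] (hX : Measurable X)
    (hXh : ∀ ω, (X ω).IsHermitian) (hz : 0 < z.im) :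
    Integrable (fun ω => powTrace z p (X ω)) μ :=
  Integrable.of_bound (measurable_powTrace z p hX).aestronglyMeasurable
    (d * z.im⁻¹ ^ (2 * p)) (.of_forall fun ω => by
      rw [Real.norm_of_nonneg (powTrace_nonneg (hXh ω))]; exact powTrace_le (hXh ω) hz)

lemma integrable_powTraceD1 (hX : Measurable X) (hXh : ∀ ω, (X ω).IsHermitian) (hz : 0 < z.im)
    (hY : Measurable Y) (hYi : Integrable (fun ω => ‖Y ω‖) μ) :
    Integrable (fun ω => powTraceD1 z p (X ω) (Y ω)) μ :=
  (hYi.const_mul _).mono' (measurable_powTraceD1 z p hX hY).aestronglyMeasurable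
    (.of_forall fun ω => abs_powTraceD1_le (hXh ω) hz (Y ω))

lemma integrable_powTraceD2 (hX : Measurable X) (hXh : ∀ ω, (X ω).IsHermitian) (hz : 0 < z.im)
    (hY : Measurable Y) (hY' : Measurable Y') (hYi : Integrable (fun ω => ‖Y ω‖ * ‖Y' ω‖) μ) :
    Integrable (fun ω => powTraceD2 z p (X ω) (Y ω) (Y' ω)) μ :=
  (hYi.const_mul _).mono' (measurable_powTraceD2 z p hX hY hY').aestronglyMeasurable
    (.of_forall fun ω => abs_powTraceD2_le (hXh ω) hz (Y ω) (Y' ω))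

lemma integrable_hs_res_pow_mul_sq [IsProbabilityMeasure μ] (hX : Measurable X)
    (hXh : ∀ ω, (X ω).IsHermitian) (hz : 0 < z.im) (hY : Measurable Y) (hYb : ∀ᵐ ω ∂μ, ‖Y ω‖ ≤ R) :
    Integrable (fun ω => hs (res z (X ω) ^ p * Y ω) ^ 2) μ := by
  refine Integrable.of_bound (measurable_hs_res_pow_mul_sq z p hX hY).aestronglyMeasurable
    ((z.im⁻¹ ^ p * R * hs (1 : Matrix (Fin d) (Fin d) ℂ)) ^ 2) ?_
  filter_upwards [hYb] with ω hω
  rw [Real.norm_of_nonneg (sq_nonneg _)]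
  refine pow_le_pow_left₀ (hs_nonneg _) ((hs_le_norm _).trans ?_) 2
  exact mul_le_mul_of_nonneg_right (norm_mul_le_of_le (norm_res_pow_le (hXh ω) hz p) hω)
    (hs_nonneg _)

/-- The contribution of one bounded summand `Y` of the matrix `B + t Y` to the derivative of the
interpolation. The matrix `Y'` has the law of `Y` given `B`, while being independent of `Y`. -/
lemma abs_integral_powTraceD1_sub_le [IsProbabilityMeasure μ]
    {B : T → Matrix (Fin d) (Fin d) ℂ} {t : ℝ} (hp : 1 ≤ p)
    (hB : Measurable B) (hY : Measurable Y) (hY' : Measurable Y')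
    (hBh : ∀ ω, (B ω).IsHermitian) (hYh : ∀ ω, (Y ω).IsHermitian)
    (hYh' : ∀ ω, (Y' ω).IsHermitian) (hYb : ∀ᵐ ω ∂μ, ‖Y ω‖ ≤ R) (hYb' : ∀ᵐ ω ∂μ, ‖Y' ω‖ ≤ R)
    (hid : IdentDistrib (fun ω => (B ω, Y ω)) (fun ω => (B ω, Y' ω)) μ μ)
    (hmean : ∫ ω, powTraceD1 z p (B ω) (Y' ω) ∂μ = 0)
    (hz : 0 < z.im) (hε : p * R * z.im⁻¹ ≤ 1 / 6) (ht : |t| ≤ 1) :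
    |∫ ω, powTraceD1 z p (B ω + t • Y ω) (Y ω) ∂μ
        - t * ∫ ω, powTraceD2 z p (B ω + t • Y ω) (Y' ω) (Y' ω) ∂μ| ≤
      2016 * p ^ 3 * R * z.im⁻¹ ^ 3 *
        ∫ ω, hs (res z (B ω + t • Y ω) ^ p * Y' ω) ^ 2 ∂μ := by
  have hR0 : 0 ≤ R := by
    obtain ⟨ω, hω⟩ := hYb.exists
    exact (norm_nonneg _).trans hω
  have hS : Measurable fun ω => B ω + t • Y ω := hB.add (hY.const_smul t)
  have hSh : ∀ ω, (B ω + t • Y ω).IsHermitian := fun ω =>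
    (hBh ω).add (isHermitian_smul_real (hYh ω) t)
  have nY : Integrable (fun ω => ‖Y ω‖) μ := Integrable.of_bound hY.norm.aestronglyMeasurable R
    (by filter_upwards [hYb] with ω hω; rwa [norm_norm])
  have sq_int : ∀ V : T → Matrix (Fin d) (Fin d) ℂ, Measurable V → (∀ᵐ ω ∂μ, ‖V ω‖ ≤ R) →
      Integrable (fun ω => ‖V ω‖ * ‖V ω‖) μ := fun V hV hVb =>
    Integrable.of_bound (hV.norm.mul hV.norm).aestronglyMeasurable (R * R) (by
      filter_upwards [hVb] with ω hω
      rw [Real.norm_of_nonneg (by positivity)]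
      exact mul_le_mul hω hω (norm_nonneg _) hR0)
  have i1 := integrable_powTraceD1 (p := p) hS hSh hz hY nY
  have i2 := integrable_powTraceD1 (p := p) hB hBh hz hY nY
  have i3 := integrable_powTraceD2 (p := p) hB hBh hz hY hY (sq_int Y hY hYb)
  have i4 := integrable_powTraceD2 (p := p) hB hBh hz hY' hY' (sq_int Y' hY' hYb')
  have i5 := integrable_powTraceD2 (p := p) hS hSh hz hY' hY' (sq_int Y' hY' hYb')
  have j1 := integrable_hs_res_pow_mul_sq (p := p) hB hBh hz hY hYb
  have j2 := integrable_hs_res_pow_mul_sq (p := p) hB hBh hz hY' hYb'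
  have j3 := integrable_hs_res_pow_mul_sq (p := p) hS hSh hz hY' hYb'
  -- The laws of `(B, Y)` and `(B, Y')` agree.
  have e1 : ∫ ω, powTraceD1 z p (B ω) (Y ω) ∂μ = 0 := by
    rw [← hmean]
    exact (hid.comp (measurable_powTraceD1 z p measurable_fst measurable_snd)).integral_eq
  have e2 : ∫ ω, powTraceD2 z p (B ω) (Y ω) (Y ω) ∂μ =
      ∫ ω, powTraceD2 z p (B ω) (Y' ω) (Y' ω) ∂μ :=
    (hid.comp (measurable_powTraceD2 z p measurable_fst measurable_snd
      measurable_snd)).integral_eq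
  have e3 : ∫ ω, hs (res z (B ω) ^ p * Y ω) ^ 2 ∂μ = ∫ ω, hs (res z (B ω) ^ p * Y' ω) ^ 2 ∂μ :=
    (hid.comp (measurable_hs_res_pow_mul_sq z p measurable_fst measurable_snd)).integral_eq
  set κ := p ^ 3 * R * z.im⁻¹ ^ 3 with hκ
  have hκ0 : 0 ≤ κ := by positivity
  set α := ∫ ω, hs (res z (B ω) ^ p * Y ω) ^ 2 ∂μ with hα
  set β := ∫ ω, hs (res z (B ω + t • Y ω) ^ p * Y' ω) ^ 2 ∂μ with hβ
  -- Taylor expansion of the first term at `B`, whose value at `B` has mean zero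
  have b1 : |∫ ω, powTraceD1 z p (B ω + t • Y ω) (Y ω) ∂μ
      - t * ∫ ω, powTraceD2 z p (B ω) (Y ω) (Y ω) ∂μ| ≤ 288 * κ * α := by
    have h : ∫ ω, powTraceD1 z p (B ω + t • Y ω) (Y ω) ∂μ
        - t * ∫ ω, powTraceD2 z p (B ω) (Y ω) (Y ω) ∂μ =
        ∫ ω, (powTraceD1 z p (B ω + t • Y ω) (Y ω) - powTraceD1 z p (B ω) (Y ω)
          - t * powTraceD2 z p (B ω) (Y ω) (Y ω)) ∂μ := by
      have h1 := integral_sub (i1.sub i2) (i3.const_mul t)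
      simp only [Pi.sub_apply] at h1
      rw [h1, integral_sub i1 i2, integral_const_mul, e1, sub_zero]
    rw [h, hα, ← integral_const_mul, ← Real.norm_eq_abs]
    refine norm_integral_le_of_norm_le (j1.const_mul _) ?_
    filter_upwards [hYb] with ω hω
    have := abs_powTraceD1_sub_sub_le (t := t) hp (hBh ω) (hYh ω) hz hω hε ht
    rw [Real.norm_eq_abs]
    convert this using 1
    rw [hκ]; ring
  -- the second derivative in the direction `Y'` may be moved to `B` as well
  have b2 : |∫ ω, powTraceD2 z p (B ω + t • Y ω) (Y' ω) (Y' ω) ∂μ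
      - ∫ ω, powTraceD2 z p (B ω) (Y' ω) (Y' ω) ∂μ| ≤ 216 * κ * α := by
    have h : 216 * κ * α = ∫ ω, 24 * κ * (5 * hs (res z (B ω) ^ p * Y ω) ^ 2 +
        4 * hs (res z (B ω) ^ p * Y' ω) ^ 2) ∂μ := by
      rw [integral_const_mul, integral_add (j1.const_mul 5) (j2.const_mul 4), integral_const_mul,
        integral_const_mul, ← e3]
      ring
    rw [← integral_sub i5 i4, h, ← Real.norm_eq_abs]
    refine norm_integral_le_of_norm_le (((j1.const_mul 5).add (j2.const_mul 4)).const_mul _) ?_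
    filter_upwards [hYb, hYb'] with ω hω hω'
    have := abs_powTraceD2_sub_le (t := t) hp (hBh ω) (hYh ω) (hYh' ω) hz hω hω' hε ht
    rw [Real.norm_eq_abs]
    convert this using 1
    rw [hκ]; ring
  -- back from the resolvent at `B` to the one at `B + t Y`
  have b3 : α ≤ 4 * β := by
    have h : α ≤ 2 * β + α / 2 := by
      have h' : 2 * β + α / 2 = ∫ ω, (2 * hs (res z (B ω + t • Y ω) ^ p * Y' ω) ^ 2 +
          hs (res z (B ω) ^ p * Y ω) ^ 2 / 2) ∂μ := by
        rw [integral_add (j3.const_mul 2) (j1.div_const 2), integral_const_mul, integral_div]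
      rw [h', e3]
      refine integral_mono_ae j2 ((j3.const_mul 2).add (j1.div_const 2)) ?_
      filter_upwards [hYb, hYb'] with ω hω hω'
      exact (hs_res_add_pow_mul_sq_le (t := t) (hBh ω) (hYh ω) hz hω hω' hε ht).2
    linarith
  rw [e2] at b1
  have b4 := abs_sub_le (∫ ω, powTraceD1 z p (B ω + t • Y ω) (Y ω) ∂μ)
    (t * ∫ ω, powTraceD2 z p (B ω) (Y' ω) (Y' ω) ∂μ)
    (t * ∫ ω, powTraceD2 z p (B ω + t • Y ω) (Y' ω) (Y' ω) ∂μ)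
  rw [← mul_sub, abs_mul, abs_sub_comm (∫ ω, powTraceD2 z p (B ω) (Y' ω) (Y' ω) ∂μ)] at b4
  have b5 := mul_le_of_le_one_left (abs_nonneg (∫ ω, powTraceD2 z p (B ω + t • Y ω) (Y' ω) (Y' ω)
    ∂μ - ∫ ω, powTraceD2 z p (B ω) (Y' ω) (Y' ω) ∂μ)) ht
  have b6 := mul_le_mul_of_nonneg_left b3 hκ0
  -- `504 = 288 + 216`, and `2016 = 4 * 504`
  calc _ ≤ 504 * (κ * α) := by linarith
    _ ≤ 504 * (κ * (4 * β)) := by linarith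
    _ = _ := by rw [hκ]; ring

end Integrability

end Measurability

/-! ### Gaussian integration by parts -/

/-- The derivative of `powTrace` at `X`, as a continuous linear functional. -/
def powTraceD1L (z : ℂ) (p : ℕ) (X : Matrix (Fin d) (Fin d) ℂ) :
    Matrix (Fin d) (Fin d) ℂ →L[ℝ] ℝ :=
  (2 * p : ℝ) • reTrace ∘L
    ContinuousLinearMap.mul ℝ (Matrix (Fin d) (Fin d) ℂ) (res z X ^ (p + 1) * (res z X)ᴴ ^ p)

lemma powTraceD1_add (z : ℂ) (p : ℕ) (X Y Y' : Matrix (Fin d) (Fin d) ℂ) :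
    powTraceD1 z p X (Y + Y') = powTraceD1 z p X Y + powTraceD1 z p X Y' :=
  map_add (powTraceD1L z p X) Y Y'

lemma powTraceD1_smul (z : ℂ) (p : ℕ) (X : Matrix (Fin d) (Fin d) ℂ) (c : ℝ)
    (Y : Matrix (Fin d) (Fin d) ℂ) :
    powTraceD1 z p X (c • Y) = c * powTraceD1 z p X Y :=
  map_smul (powTraceD1L z p X) c Y

lemma powTraceD1_sum (z : ℂ) (p : ℕ) (X : Matrix (Fin d) (Fin d) ℂ) {n : ℕ}
    (Y : Fin n → Matrix (Fin d) (Fin d) ℂ) :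
    powTraceD1 z p X (∑ i, Y i) = ∑ i, powTraceD1 z p X (Y i) :=
  map_sum (powTraceD1L z p X) Y Finset.univ

section Gaussian

variable {T : Type*} [MeasurableSpace T] {Q : Measure T} {H : T → Matrix (Fin d) (Fin d) ℂ}
  {z : ℂ} {p : ℕ}

lemma integral_powTraceD1_eq_zero (X : Matrix (Fin d) (Fin d) ℂ) (hi : Integrable H Q)
    (h0 : ∫ ω, H ω ∂Q = 0) : ∫ ω, powTraceD1 z p X (H ω) ∂Q = 0 := by
  have h := (powTraceD1L z p X).integral_comp_comm hi
  rw [h0, map_zero] at h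
  exact h

lemma dpow_smul (A Y : Matrix (Fin d) (Fin d) ℂ) (c : ℝ) (m : ℕ) :
    dpow A (c • Y) m = c • dpow A Y m := by
  simp only [dpow, Finset.smul_sum, mul_smul_comm, smul_mul_assoc]

lemma powTraceD2_smul_left (X Y Y' : Matrix (Fin d) (Fin d) ℂ) (c : ℝ) :
    powTraceD2 z p X (c • Y) Y' = c * powTraceD2 z p X Y Y' := by
  have h : dprod (res z X) (c • Y) p * Y' = c • (dprod (res z X) Y p * Y') := by
    simp only [dprod, dpow_smul, mul_smul_comm, smul_mul_assoc, ← smul_add]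
  rw [powTraceD2, h, ← reTrace_apply, map_smul, reTrace_apply, smul_eq_mul, powTraceD2]
  ring

lemma norm_cos_smul_add_sin_smul_le (U V : Matrix (Fin d) (Fin d) ℂ) (a b : ℝ) (ha : |a| ≤ 1)
    (hb : |b| ≤ 1) : ‖a • U + b • V‖ ≤ ‖U‖ + ‖V‖ := by
  refine norm_add_le_of_le ?_ ?_ <;> rw [norm_smul, Real.norm_eq_abs]
  · exact mul_le_of_le_one_left (norm_nonneg _) ha
  · exact mul_le_of_le_one_left (norm_nonneg _) hb

lemma measurable_real_combination {U V : T → Matrix (Fin d) (Fin d) ℂ} (hU : Measurable U)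
    (hV : Measurable V) (a b : ℝ) : Measurable fun q => a • U q + b • V q := by
  fun_prop

lemma isHermitian_real_combination {U V : Matrix (Fin d) (Fin d) ℂ} (hU : U.IsHermitian)
    (hV : V.IsHermitian) (a b : ℝ) : (a • U + b • V).IsHermitian :=
  (isHermitian_smul_real hU a).add (isHermitian_smul_real hV b)

lemma hasDerivAt_rotation (U V : Matrix (Fin d) (Fin d) ℂ) (θ : ℝ) :
    HasDerivAt (fun t => Real.cos t • U + Real.sin t • V)
      (-Real.sin θ • U + Real.cos θ • V) θ :=
  ((Real.hasDerivAt_cos θ).smul_const U).add ((Real.hasDerivAt_sin θ).smul_const V)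

/-- The joint law of two independent copies of a centred Gaussian vector is invariant under
rotations. -/
lemma integral_prod_rotation {E : Type*} [NormedAddCommGroup E] [NormedSpace ℝ E] [CompleteSpace E]
    [MeasurableSpace E] [BorelSpace E] [SecondCountableTopology E] [IsProbabilityMeasure Q]
    {H : T → E} (hH : Measurable H) (hG : HasGaussianLaw H Q) (h0 : ∫ ω, H ω ∂Q = 0)
    {h : E × E → ℝ} (hm : Measurable h) (θ : ℝ) :
    ∫ q, h (Real.cos θ • H q.1 + Real.sin θ • H q.2, -Real.sin θ • H q.1 + Real.cos θ • H q.2)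
      ∂(Q.prod Q) = ∫ q, h (H q.1, H q.2) ∂(Q.prod Q) := by
  set μ := Q.map H with hμ
  have hgauss : IsGaussian μ := hG.isGaussian_map
  have hμ0 : μ[id] = 0 := by
    rw [hμ, integral_map hH.aemeasurable measurable_id.aestronglyMeasurable]
    exact h0
  have hrot := IsGaussian.map_rotation_eq_self hμ0 θ
  have hprod : μ.prod μ = (Q.prod Q).map (Prod.map H H) := Measure.map_prod_map Q Q hH hH
  have hrm : Measurable (ContinuousLinearMap.rotation (E := E) θ) :=
    (ContinuousLinearMap.continuous _).measurable
  have hHH : Measurable (Prod.map H H) := hH.prodMap hH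
  have e1 : ∫ w, h (ContinuousLinearMap.rotation θ w) ∂(μ.prod μ) = ∫ w, h w ∂(μ.prod μ) := by
    conv_rhs => rw [← hrot]
    rw [integral_map hrm.aemeasurable hm.aestronglyMeasurable]
  rw [hprod, integral_map hHH.aemeasurable hm.aestronglyMeasurable] at e1
  exact (integral_map hHH.aemeasurable (hm.comp hrm).aestronglyMeasurable).symm.trans e1

/-- Rotation invariance for a centred matrix with jointly Gaussian entries. -/
lemma integral_prod_rotation_matrix [IsProbabilityMeasure Q] (hH : Measurable H)
    (hG : HasGaussianLaw (fun ω (a b : Fin d) => H ω a b) Q)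
    (h0 : ∀ a b, ∫ ω, H ω a b ∂Q = 0)
    {h : Matrix (Fin d) (Fin d) ℂ × Matrix (Fin d) (Fin d) ℂ → ℝ} (hm : Measurable h) (θ : ℝ) :
    ∫ q, h (Real.cos θ • H q.1 + Real.sin θ • H q.2, -Real.sin θ • H q.1 + Real.cos θ • H q.2)
      ∂(Q.prod Q) = ∫ q, h (H q.1, H q.2) ∂(Q.prod Q) := by
  have hH' : Measurable fun ω (a b : Fin d) => H ω a b := hH
  have hm' : Measurable fun w : (Fin d → Fin d → ℂ) × (Fin d → Fin d → ℂ) =>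
      h (Matrix.of w.1, Matrix.of w.2) := hm
  refine integral_prod_rotation hH' hG ?_ hm' θ
  have hi : ∀ a, Integrable (fun ω b => H ω a b) Q := fun a => (hG.integrable).eval a
  funext a
  rw [eval_integral (fun a => hi a)]
  funext b
  rw [eval_integral (fun b => (hi a).eval b)]
  exact h0 a b

section

variable [NeZero d] [IsProbabilityMeasure Q] {X : Matrix (Fin d) (Fin d) ℂ}

/-- The consequence of rotation invariance that is differentiated at angle zero: the second copy is
`sin θ` times the first rotated copy plus `cos θ` times the second one, and the latter is centred
and independent of the former. -/
lemma integral_prod_powTraceD1_rotation (hH : Measurable H)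
    (hHh : ∀ ω, (H ω).IsHermitian) (hG : HasGaussianLaw (fun ω (a b : Fin d) => H ω a b) Q)
    (h0 : ∀ a b, ∫ ω, H ω a b ∂Q = 0) (hHi : Integrable H Q) (h0' : ∫ ω, H ω ∂Q = 0)
    (hX : X.IsHermitian) (hz : 0 < z.im) (c θ : ℝ) :
    ∫ q, powTraceD1 z p (X + c • (Real.cos θ • H q.1 + Real.sin θ • H q.2)) (H q.2) ∂(Q.prod Q) =
      Real.sin θ * ∫ ω, powTraceD1 z p (X + c • H ω) (H ω) ∂Q := by
  have hU : Measurable fun q : T × T => H q.1 := hH.comp measurable_fst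
  have hV : Measurable fun q : T × T => H q.2 := hH.comp measurable_snd
  have hm : Measurable fun w : Matrix (Fin d) (Fin d) ℂ × Matrix (Fin d) (Fin d) ℂ =>
      powTraceD1 z p (X + c • w.1) (Real.sin θ • w.1 + Real.cos θ • w.2) :=
    measurable_powTraceD1 z p ((measurable_fst.const_smul c).const_add X)
      ((measurable_fst.const_smul (Real.sin θ)).add (measurable_snd.const_smul (Real.cos θ)))
  have e1 := integral_prod_rotation_matrix hH hG h0 hm θ
  have e (q : T × T) : Real.sin θ • (Real.cos θ • H q.1 + Real.sin θ • H q.2) +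
      Real.cos θ • (-Real.sin θ • H q.1 + Real.cos θ • H q.2) = H q.2 := by
    have h1 : Real.sin θ • (Real.cos θ • H q.1 + Real.sin θ • H q.2) +
      Real.cos θ • (-Real.sin θ • H q.1 + Real.cos θ • H q.2) =
        (Real.sin θ ^ 2 + Real.cos θ ^ 2) • H q.2 := by module
    rw [h1, Real.sin_sq_add_cos_sq, one_smul]
  simp only [e] at e1
  rw [e1]
  have i1 : Integrable (fun q : T × T => powTraceD1 z p (X + c • H q.1) (H q.1)) (Q.prod Q) :=
    integrable_powTraceD1 ((hU.const_smul c).const_add X)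
      (fun q => hX.add (isHermitian_smul_real (hHh _) c)) hz hU (hHi.norm.comp_fst Q)
  have i2 : Integrable (fun q : T × T => powTraceD1 z p (X + c • H q.1) (H q.2)) (Q.prod Q) :=
    integrable_powTraceD1 ((hU.const_smul c).const_add X)
      (fun q => hX.add (isHermitian_smul_real (hHh _) c)) hz hV (hHi.norm.comp_snd Q)
  simp only [powTraceD1_add, powTraceD1_smul]
  rw [integral_add (i1.const_mul _) (i2.const_mul _), integral_const_mul, integral_const_mul,
    integral_prod _ i1, integral_prod _ i2]
  simp only [integral_powTraceD1_eq_zero _ hHi h0', integral_zero, integral_const, probReal_univ,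
    one_smul, mul_zero, add_zero]

lemma hasDerivAt_integral_prod_powTraceD1 (hH : Measurable H)
    (hHh : ∀ ω, (H ω).IsHermitian) (hHi : Integrable H Q)
    (hH2 : Integrable (fun ω => ‖H ω‖ * ‖H ω‖) Q) (hX : X.IsHermitian) (hz : 0 < z.im) (c : ℝ) :
    HasDerivAt (fun θ => ∫ q, powTraceD1 z p
      (X + c • (Real.cos θ • H q.1 + Real.sin θ • H q.2)) (H q.2) ∂(Q.prod Q))
      (c * ∫ q, powTraceD2 z p (X + c • H q.1) (H q.2) (H q.2) ∂(Q.prod Q)) 0 := by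
  have hU : Measurable fun q : T × T => H q.1 := hH.comp measurable_fst
  have hV : Measurable fun q : T × T => H q.2 := hH.comp measurable_snd
  have hVn : Integrable (fun q : T × T => ‖H q.2‖) (Q.prod Q) := hHi.norm.comp_snd Q
  have hUV : Integrable (fun q : T × T => ‖H q.1‖ * ‖H q.2‖) (Q.prod Q) :=
    hHi.norm.mul_prod hHi.norm
  have hVV : Integrable (fun q : T × T => ‖H q.2‖ * ‖H q.2‖) (Q.prod Q) := hH2.comp_snd Q
  let S : ℝ → T × T → Matrix (Fin d) (Fin d) ℂ := fun θ q =>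
    X + c • (Real.cos θ • H q.1 + Real.sin θ • H q.2)
  let S' : ℝ → T × T → Matrix (Fin d) (Fin d) ℂ := fun θ q =>
    c • (-Real.sin θ • H q.1 + Real.cos θ • H q.2)
  have hSm : ∀ θ, Measurable (S θ) := fun θ =>
    ((measurable_real_combination hU hV (Real.cos θ) (Real.sin θ)).const_smul c).const_add X
  have hS'm : ∀ θ, Measurable (S' θ) := fun θ =>
    (measurable_real_combination hU hV (-Real.sin θ) (Real.cos θ)).const_smul c
  have hSh : ∀ θ q, (S θ q).IsHermitian := fun θ q => hX.add (isHermitian_smul_real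
    (isHermitian_real_combination (hHh q.1) (hHh q.2) (Real.cos θ) (Real.sin θ)) c)
  have hS'h : ∀ θ q, (S' θ q).IsHermitian := fun θ q => isHermitian_smul_real
    (isHermitian_real_combination (hHh q.1) (hHh q.2) (-Real.sin θ) (Real.cos θ)) c
  have hSd : ∀ θ q, HasDerivAt (fun θ => S θ q) (S' θ q) θ := fun θ q =>
    ((hasDerivAt_rotation (H q.1) (H q.2) θ).const_smul c).const_add X
  have hb : ∀ θ q, ‖powTraceD2 z p (S θ q) (S' θ q) (H q.2)‖ ≤
      2 * p * d * (2 * p + 1) * z.im⁻¹ ^ (2 * p + 2) *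
        (|c| * (‖H q.1‖ * ‖H q.2‖ + ‖H q.2‖ * ‖H q.2‖)) := by
    intro θ q
    refine (abs_powTraceD2_le (hSh θ q) hz _ _).trans ?_
    refine mul_le_mul_of_nonneg_left ?_ (by positivity)
    have h : ‖S' θ q‖ ≤ |c| * (‖H q.1‖ + ‖H q.2‖) := by
      rw [norm_smul, Real.norm_eq_abs]
      exact mul_le_mul_of_nonneg_left (norm_cos_smul_add_sin_smul_le _ _ _ _
        (by rw [abs_neg]; exact Real.abs_sin_le_one θ) (Real.abs_cos_le_one θ)) (abs_nonneg c)
    calc _ ≤ |c| * (‖H q.1‖ + ‖H q.2‖) * ‖H q.2‖ := by gcongr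
      _ = _ := by ring
  have key := (hasDerivAt_integral_of_dominated_loc_of_deriv_le (s := Set.univ) (x₀ := (0 : ℝ))
      (F := fun θ q => powTraceD1 z p (S θ q) (H q.2))
      (F' := fun θ q => powTraceD2 z p (S θ q) (S' θ q) (H q.2)) Filter.univ_mem
      (.of_forall fun θ => (measurable_powTraceD1 z p (hSm θ) hV).aestronglyMeasurable)
      (integrable_powTraceD1 (hSm 0) (hSh 0) hz hV hVn)
      (measurable_powTraceD2 z p (hSm 0) (hS'm 0) hV).aestronglyMeasurable
      (.of_forall fun q θ _ => hb θ q) (((hUV.add hVV).const_mul _).const_mul _)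
      (.of_forall fun q θ _ => hasDerivAt_powTraceD1 hz (hSh θ q) (hS'h θ q) (hSd θ q) _)).2
  refine key.congr_deriv ?_
  rw [← integral_const_mul]
  refine integral_congr_ae (.of_forall fun q => ?_)
  simp [S, S', powTraceD2_smul_left]

/-- Integration by parts for a centred Gaussian matrix `H`. It is obtained by differentiating,
at angle zero, the identity expressing the invariance of the law of two independent copies of `H`
under rotations. -/
lemma integral_powTraceD1_gaussian (hH : Measurable H)
    (hHh : ∀ ω, (H ω).IsHermitian) (hG : HasGaussianLaw (fun ω (a b : Fin d) => H ω a b) Q)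
    (h0 : ∀ a b, ∫ ω, H ω a b ∂Q = 0) (hHi : Integrable H Q) (h0' : ∫ ω, H ω ∂Q = 0)
    (hH2 : Integrable (fun ω => ‖H ω‖ * ‖H ω‖) Q) (hX : X.IsHermitian) (hz : 0 < z.im) (c : ℝ) :
    ∫ ω, powTraceD1 z p (X + c • H ω) (H ω) ∂Q =
      c * ∫ q, powTraceD2 z p (X + c • H q.1) (H q.2) (H q.2) ∂(Q.prod Q) := by
  have h1 := hasDerivAt_integral_prod_powTraceD1 (p := p) hH hHh hHi hH2 hX hz c
  have h2 := (Real.hasDerivAt_sin 0).mul_const (∫ ω, powTraceD1 z p (X + c • H ω) (H ω) ∂Q)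
  rw [Real.cos_zero, one_mul] at h2
  exact (h2.congr_of_eventuallyEq (.of_forall fun θ =>
    integral_prod_powTraceD1_rotation hH hHh hG h0 hHi h0' hX hz c θ)).unique h1

end

end Gaussian

/-! ### Random matrices and their entries -/

section RandomMatrices

variable {T : Type*} [MeasurableSpace T] {Q : Measure T}
  {H : T → Matrix (Fin d) (Fin d) ℂ}

/-- The evaluation of an entry, as a continuous linear functional. -/
def entryL (a b : Fin d) : Matrix (Fin d) (Fin d) ℂ →L[ℝ] ℂ :=
  LinearMap.toContinuousLinearMap (Matrix.entryLinearMap ℝ ℂ a b)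

lemma norm_le_sum_entries (M : Matrix (Fin d) (Fin d) ℂ) :
    ‖M‖ ≤ ∑ a, ∑ b, ‖Matrix.single a b (1 : ℂ)‖ * ‖M a b‖ := by
  conv_lhs => rw [Matrix.matrix_eq_sum_single M]
  refine norm_sum_le_of_le _ fun a _ => norm_sum_le_of_le _ fun b _ => le_of_eq ?_
  rw [← mul_one (M a b), ← smul_eq_mul, ← Matrix.smul_single, norm_smul, smul_eq_mul, mul_one,
    mul_comm]

lemma memLp_of_entries {q : ℝ≥0∞} (hH : Measurable H)
    (h : ∀ a b, MemLp (fun ω => H ω a b) q Q) : MemLp H q Q := by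
  have h1 : MemLp (fun ω => ∑ a, ∑ b, ‖Matrix.single a b (1 : ℂ)‖ * ‖H ω a b‖) q Q :=
    memLp_finsetSum _ fun a _ => memLp_finsetSum _ fun b _ => (h a b).norm.const_mul _
  exact h1.mono' hH.aestronglyMeasurable (.of_forall fun ω => norm_le_sum_entries (H ω))

lemma integrable_of_entries (hH : Measurable H)
    (h : ∀ a b, Integrable (fun ω => H ω a b) Q) : Integrable H Q :=
  memLp_one_iff_integrable.mp (memLp_of_entries hH fun a b =>
    memLp_one_iff_integrable.mpr (h a b))

lemma integral_apply_entry (h : Integrable H Q) (a b : Fin d) :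
    (∫ ω, H ω ∂Q) a b = ∫ ω, H ω a b ∂Q :=
  ((entryL a b).integral_comp_comm h).symm

lemma expect_eq_integral (h : Integrable H Q) : expect Q H = ∫ ω, H ω ∂Q := by
  ext a b
  rw [integral_apply_entry h]
  rfl

lemma IsSARandomMatrix.measurable {Y : T → Matrix (Fin d) (Fin d) ℂ} (h : IsSARandomMatrix Y) :
    Measurable Y :=
  measurable_of_entry h.measurable_entry

/-! ### Quadratic expressions in a random matrix -/

lemma bilin_apply_self (β : Matrix (Fin d) (Fin d) ℂ →ₗ[ℂ] Matrix (Fin d) (Fin d) ℂ →ₗ[ℂ] ℂ)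
    (Y : Matrix (Fin d) (Fin d) ℂ) :
    β Y Y = ∑ x : Fin d × Fin d, ∑ y : Fin d × Fin d,
      Y x.1 x.2 * Y y.1 y.2 * β (Matrix.single x.1 x.2 1) (Matrix.single y.1 y.2 1) := by
  have h : Y = ∑ x : Fin d × Fin d, Y x.1 x.2 • Matrix.single x.1 x.2 (1 : ℂ) := by
    conv_lhs => rw [Matrix.matrix_eq_sum_single Y]
    rw [Fintype.sum_prod_type]
    simp [Matrix.smul_single]
  conv_lhs => rw [h]
  rw [LinearMap.map_sum₂]
  refine Finset.sum_congr rfl fun x _ => ?_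
  rw [map_sum]
  refine Finset.sum_congr rfl fun y _ => ?_
  rw [map_smul, map_smul, LinearMap.smul_apply, smul_eq_mul, smul_eq_mul]
  ring

lemma integrable_mul_entries (h : ∀ a b, MemLp (fun ω => H ω a b) 2 Q) (x y : Fin d × Fin d) :
    Integrable (fun ω => H ω x.1 x.2 * H ω y.1 y.2) Q :=
  (h x.1 x.2).integrable_mul (h y.1 y.2)

lemma integrable_bilin (h : ∀ a b, MemLp (fun ω => H ω a b) 2 Q)
    (β : Matrix (Fin d) (Fin d) ℂ →ₗ[ℂ] Matrix (Fin d) (Fin d) ℂ →ₗ[ℂ] ℂ) :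
    Integrable (fun ω => β (H ω) (H ω)) Q := by
  simp only [bilin_apply_self β]
  exact integrable_finsetSum _ fun x _ => integrable_finsetSum _ fun y _ =>
    (integrable_mul_entries h x y).mul_const _

/-- The mean of a quadratic expression involves only the second moments of the entries. -/
lemma integral_re_bilin (h : ∀ a b, MemLp (fun ω => H ω a b) 2 Q)
    (β : Matrix (Fin d) (Fin d) ℂ →ₗ[ℂ] Matrix (Fin d) (Fin d) ℂ →ₗ[ℂ] ℂ) :
    ∫ ω, (β (H ω) (H ω)).re ∂Q = ∑ x : Fin d × Fin d, ∑ y : Fin d × Fin d,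
      ((∫ ω, H ω x.1 x.2 * H ω y.1 y.2 ∂Q) *
        β (Matrix.single x.1 x.2 1) (Matrix.single y.1 y.2 1)).re := by
  have h1 : ∫ ω, (β (H ω) (H ω)).re ∂Q = (∫ ω, β (H ω) (H ω) ∂Q).re :=
    Complex.reCLM.integral_comp_comm (integrable_bilin h β)
  rw [h1]
  simp only [bilin_apply_self β]
  rw [integral_finsetSum _ fun x _ => integrable_finsetSum _ fun y _ =>
    (integrable_mul_entries h x y).mul_const _, Complex.re_sum]
  refine Finset.sum_congr rfl fun x _ => ?_
  rw [integral_finsetSum _ fun y _ => (integrable_mul_entries h x y).mul_const _, Complex.re_sum]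
  refine Finset.sum_congr rfl fun y _ => ?_
  rw [integral_mul_const]

/-- The expectation of a quadratic expression is additive as soon as the second moments of the
entries are. -/
lemma integral_re_bilin_eq_sum {Ω : Type*} [MeasurableSpace Ω] {P : Measure Ω} {n : ℕ}
    {Z : Fin n → Ω → Matrix (Fin d) (Fin d) ℂ} (h : ∀ a b, MemLp (fun ω => H ω a b) 2 Q)
    (hZ : ∀ i a b, MemLp (fun ω => Z i ω a b) 2 P)
    (hHZ : ∀ x y : Fin d × Fin d, ∫ ω, H ω x.1 x.2 * H ω y.1 y.2 ∂Q =
      ∑ i, ∫ ω, Z i ω x.1 x.2 * Z i ω y.1 y.2 ∂P)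
    (β : Matrix (Fin d) (Fin d) ℂ →ₗ[ℂ] Matrix (Fin d) (Fin d) ℂ →ₗ[ℂ] ℂ) :
    ∫ ω, (β (H ω) (H ω)).re ∂Q = ∑ i, ∫ ω, (β (Z i ω) (Z i ω)).re ∂P := by
  rw [integral_re_bilin h]
  simp only [integral_re_bilin (hZ _), hHZ, Finset.sum_mul, Complex.re_sum]
  conv_rhs => rw [Finset.sum_comm]
  refine Finset.sum_congr rfl fun x _ => ?_
  rw [Finset.sum_comm]

/-- The second derivative of `powTrace`, before taking the real part, as a complex bilinear form. -/
def powTraceD2Form (z : ℂ) (p : ℕ) (X : Matrix (Fin d) (Fin d) ℂ) :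
    Matrix (Fin d) (Fin d) ℂ →ₗ[ℂ] Matrix (Fin d) (Fin d) ℂ →ₗ[ℂ] ℂ :=
  LinearMap.mk₂ ℂ (fun Y Y' => 2 * p * (dprod (res z X) Y p * Y').trace)
    (fun Y₁ Y₂ Y' => by
      simp only [dprod, dpow, mul_add, add_mul, Finset.sum_add_distrib, Matrix.trace_add]; ring)
    (fun c Y Y' => by
      simp only [dprod, dpow, mul_smul_comm, smul_mul_assoc, ← Finset.smul_sum, ← smul_add,
        Matrix.trace_smul, smul_eq_mul]; ring)
    (fun Y Y₁ Y₂ => by rw [mul_add, Matrix.trace_add]; ring)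
    (fun c Y Y' => by rw [mul_smul_comm, Matrix.trace_smul, smul_eq_mul, smul_eq_mul]; ring)

lemma powTraceD2_eq_re_form (z : ℂ) (p : ℕ) (X Y Y' : Matrix (Fin d) (Fin d) ℂ) :
    powTraceD2 z p X Y Y' = (powTraceD2Form z p X Y Y').re := by
  simp only [powTraceD2Form, LinearMap.mk₂_apply, powTraceD2]
  rw [show (2 * p : ℂ) = ((2 * p : ℝ) : ℂ) by push_cast; rfl, Complex.re_ofReal_mul]

/-- The bilinear form `Tr (Y N Y')`. -/
def traceForm (N : Matrix (Fin d) (Fin d) ℂ) :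
    Matrix (Fin d) (Fin d) ℂ →ₗ[ℂ] Matrix (Fin d) (Fin d) ℂ →ₗ[ℂ] ℂ :=
  LinearMap.mk₂ ℂ (fun Y Y' => (Y * N * Y').trace)
    (fun Y₁ Y₂ Y' => by rw [add_mul, add_mul, Matrix.trace_add])
    (fun c Y Y' => by rw [smul_mul_assoc, smul_mul_assoc, Matrix.trace_smul])
    (fun Y Y₁ Y₂ => by rw [mul_add, Matrix.trace_add])
    (fun c Y Y' => by rw [mul_smul_comm, Matrix.trace_smul])

lemma hs_mul_sq_eq_re_traceForm (M : Matrix (Fin d) (Fin d) ℂ) {Y : Matrix (Fin d) (Fin d) ℂ}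
    (hY : Y.IsHermitian) : hs (M * Y) ^ 2 = (traceForm (Mᴴ * M) Y Y).re := by
  rw [hs_sq_eq_trace, Matrix.conjTranspose_mul, hY.eq, traceForm, LinearMap.mk₂_apply]
  simp only [mul_assoc]

/-- The mean of `‖M Y‖²` in the Hilbert–Schmidt norm is controlled by the operator norm of
`E[Y²]`. -/
lemma integral_hs_mul_sq_le (hH : Measurable H) (hHh : ∀ ω, (H ω).IsHermitian)
    (h : ∀ a b, MemLp (fun ω => H ω a b) 2 Q) (M : Matrix (Fin d) (Fin d) ℂ) :
    ∫ ω, hs (M * H ω) ^ 2 ∂Q ≤ specNorm (expect Q fun ω => H ω ^ 2) * hs M ^ 2 := by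
  have hi : Integrable (fun ω => H ω ^ 2) Q := by
    refine integrable_of_entries (hH.pow_const 2) fun a b => ?_
    simp only [pow_two, Matrix.mul_apply]
    exact integrable_finsetSum _ fun c _ => integrable_mul_entries h (a, c) (c, b)
  let L : Matrix (Fin d) (Fin d) ℂ →L[ℝ] ℝ :=
    reTrace ∘L ContinuousLinearMap.mul ℝ (Matrix (Fin d) (Fin d) ℂ) (Mᴴ * M)
  have h1 : ∫ ω, hs (M * H ω) ^ 2 ∂Q = L (∫ ω, H ω ^ 2 ∂Q) := by
    rw [← L.integral_comp_comm hi]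
    refine integral_congr_ae (.of_forall fun ω => ?_)
    change hs (M * H ω) ^ 2 = (Mᴴ * M * H ω ^ 2).trace.re
    rw [hs_sq_eq_trace, Matrix.conjTranspose_mul, (hHh ω).eq, mul_assoc, Matrix.trace_mul_comm,
      pow_two]
    simp only [mul_assoc]
  rw [h1, ← expect_eq_integral hi]
  set S := expect Q fun ω => H ω ^ 2
  change (Mᴴ * M * S).trace.re ≤ ‖S‖ * _
  refine (Complex.re_le_norm _).trans ?_
  rw [mul_assoc]
  refine (norm_trace_mul_le _ _).trans ?_
  rw [hs_conjTranspose, pow_two, mul_comm ‖S‖, mul_assoc]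
  exact mul_le_mul_of_nonneg_left (hs_mul_le' _ _) (hs_nonneg _)

/-! ### Second moments of the sum and of its Gaussian model -/

section Moments

variable {Ω : Type*} [MeasurableSpace Ω] {P : Measure Ω} {n : ℕ}
  {Z₀ : Matrix (Fin d) (Fin d) ℂ} {Z : Fin n → Ω → Matrix (Fin d) (Fin d) ℂ}

/-- The summands are centred and independent, so that the second moments of two
distinct summands vanish. -/
lemma integral_mul_entries_sum
    (hL2 : ∀ i a b, MemLp (fun ω => Z i ω a b) 2 P)
    (h0 : ∀ i, expect P (Z i) = 0) (hind : iIndepFun (fun i ω (a b : Fin d) => Z i ω a b) P)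
    (x y : Fin d × Fin d) :
    ∫ ω, (∑ i, Z i ω) x.1 x.2 * (∑ i, Z i ω) y.1 y.2 ∂P =
      ∑ i, ∫ ω, Z i ω x.1 x.2 * Z i ω y.1 y.2 ∂P := by
  have hint : ∀ i j, Integrable (fun ω => Z i ω x.1 x.2 * Z j ω y.1 y.2) P := fun i j =>
    (hL2 i x.1 x.2).integrable_mul (hL2 j y.1 y.2)
  have hoff : ∀ i j, i ≠ j → ∫ ω, Z i ω x.1 x.2 * Z j ω y.1 y.2 ∂P = 0 := by
    intro i j hij
    have h1 : IndepFun (fun ω => Z i ω x.1 x.2) (fun ω => Z j ω y.1 y.2) P :=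
      (hind.indepFun hij).comp (φ := fun M : Fin d → Fin d → ℂ => M x.1 x.2)
        (ψ := fun M : Fin d → Fin d → ℂ => M y.1 y.2) (by fun_prop) (by fun_prop)
    rw [h1.integral_fun_mul_eq_mul_integral (hL2 i x.1 x.2).aestronglyMeasurable
      (hL2 j y.1 y.2).aestronglyMeasurable]
    have h2 : ∫ ω, Z i ω x.1 x.2 ∂P = 0 := congrFun (congrFun (h0 i) x.1) x.2
    rw [h2, zero_mul]
  simp only [Matrix.sum_apply, Finset.sum_mul_sum]
  rw [integral_finsetSum _ fun i _ => integrable_finsetSum _ fun j _ => hint i j]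
  refine Finset.sum_congr rfl fun i _ => ?_
  rw [integral_finsetSum _ fun j _ => hint i j]
  exact Finset.sum_eq_single i (fun j _ hj => hoff i j hj.symm) (by simp)

lemma expect_model [IsProbabilityMeasure P] (hL2 : ∀ i a b, MemLp (fun ω => Z i ω a b) 2 P)
    (h0 : ∀ i, expect P (Z i) = 0) : expect P (model Z₀ Z) = Z₀ := by
  ext a b
  have hint : ∀ i, Integrable (fun ω => Z i ω a b) P := fun i =>
    (hL2 i a b).integrable one_le_two
  have h2 : ∀ i, ∫ ω, Z i ω a b ∂P = 0 := fun i => congrFun (congrFun (h0 i) a) b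
  change ∫ ω, (Z₀ + ∑ i, Z i ω) a b ∂P = Z₀ a b
  simp only [Matrix.add_apply, Matrix.sum_apply]
  rw [integral_add (integrable_const _) (integrable_finsetSum _ fun i _ => hint i),
    integral_finsetSum _ fun i _ => hint i]
  simp [h2]

variable {Ω' : Type*} [MeasurableSpace Ω'] {Q : Measure Ω'} {G : Ω' → Matrix (Fin d) (Fin d) ℂ}

/-- The centred Gaussian model has the second moments `E[H_x H_y]` (without conjugation) of the
sum: on Hermitian matrices conjugation is a transposition of the indices. -/
lemma integral_mul_entries_gaussianModel [IsProbabilityMeasure P]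
    (hZ : ∀ i, IsSARandomMatrix (Z i))
    (hL2 : ∀ i a b, MemLp (fun ω => Z i ω a b) 2 P)
    (h0 : ∀ i, expect P (Z i) = 0) (hind : iIndepFun (fun i ω (a b : Fin d) => Z i ω a b) P)
    (hZ₀ : Z₀.IsHermitian) (hG : IsGaussianModel P Q (model Z₀ Z) G) (x y : Fin d × Fin d) :
    ∫ ω, (G ω - Z₀) x.1 x.2 * (G ω - Z₀) y.1 y.2 ∂Q =
      ∑ i, ∫ ω, Z i ω x.1 x.2 * Z i ω y.1 y.2 ∂P := by
  have hQ : expect Q G = Z₀ := hG.mean_eq.trans (expect_model hL2 h0)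
  have h := congrFun (congrFun hG.cov_eq x) (y.2, y.1)
  simp only [covMatrix, Matrix.of_apply, hQ, expect_model hL2 h0] at h
  have e1 : ∀ ω, star ((G ω - Z₀) y.2 y.1) = (G ω - Z₀) y.1 y.2 := fun ω =>
    ((hG.saRandomMatrix.isHermitian ω).sub hZ₀).apply y.1 y.2
  have e2 : ∀ ω, model Z₀ Z ω - Z₀ = ∑ i, Z i ω := fun ω => by simp [model]
  have e3 : ∀ ω, star ((∑ i, Z i ω) y.2 y.1) = (∑ i, Z i ω) y.1 y.2 := fun ω =>
    (isSelfAdjoint_sum _ fun i _ => ((hZ i).isHermitian ω).isSelfAdjoint).isHermitian.apply y.1 y.2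
  simp only [e1, e2, e3] at h
  rw [h, integral_mul_entries_sum hL2 h0 hind]

lemma sigma_sq [IsProbabilityMeasure P] (hL2 : ∀ i a b, MemLp (fun ω => Z i ω a b) 2 P)
    (h0 : ∀ i, expect P (Z i) = 0) :
    sigma P (model Z₀ Z) ^ 2 = specNorm (expect P fun ω => (∑ i, Z i ω) ^ 2) := by
  have e2 : ∀ ω, model Z₀ Z ω - Z₀ = ∑ i, Z i ω := fun ω => by simp [model]
  rw [sigma, Real.sq_sqrt (show 0 ≤ specNorm _ from norm_nonneg _), expect_model hL2 h0]
  simp only [e2]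

lemma isHermitian_sum {Y : Fin n → Matrix (Fin d) (Fin d) ℂ} (h : ∀ i, (Y i).IsHermitian)
    (s : Finset (Fin n)) : (∑ i ∈ s, Y i).IsHermitian :=
  (isSelfAdjoint_sum _ fun i _ => (h i).isSelfAdjoint).isHermitian

/-- The matrix variance parameter controls the summands jointly. -/
lemma sum_integral_hs_mul_sq_le [IsProbabilityMeasure P] (hZ : ∀ i, IsSARandomMatrix (Z i))
    (hL2 : ∀ i a b, MemLp (fun ω => Z i ω a b) 2 P)
    (h0 : ∀ i, expect P (Z i) = 0) (hind : iIndepFun (fun i ω (a b : Fin d) => Z i ω a b) P)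
    (M : Matrix (Fin d) (Fin d) ℂ) :
    ∑ i, ∫ ω, hs (M * Z i ω) ^ 2 ∂P ≤ sigma P (model Z₀ Z) ^ 2 * hs M ^ 2 := by
  have hm : Measurable fun ω => ∑ i, Z i ω :=
    Finset.measurable_fun_sum _ fun i _ => (hZ i).measurable
  have hh : ∀ ω, (∑ i, Z i ω).IsHermitian := fun ω =>
    isHermitian_sum (fun i => (hZ i).isHermitian ω) _
  have hW : ∀ a b, MemLp (fun ω => (∑ i, Z i ω) a b) 2 P := fun a b => by
    simp only [Matrix.sum_apply]
    exact memLp_finsetSum _ fun i _ => hL2 i a b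
  rw [sigma_sq hL2 h0]
  refine le_trans (le_of_eq ?_) (integral_hs_mul_sq_le hm hh hW M)
  simp only [fun i ω => hs_mul_sq_eq_re_traceForm M ((hZ i).isHermitian ω),
    fun ω => hs_mul_sq_eq_re_traceForm M (hh ω)]
  exact (integral_re_bilin_eq_sum hW hL2 (integral_mul_entries_sum hL2 h0 hind) _).symm

end Moments

end RandomMatrices

/-! ### Resampling one summand -/

section Resampling

variable {Ω Ω' : Type*} [MeasurableSpace Ω] [MeasurableSpace Ω'] {P : Measure Ω} {Q : Measure Ω'}
  [IsProbabilityMeasure P] [IsProbabilityMeasure Q]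

/-- If `U` and `V` are independent, then `V` may be replaced by an independent copy in any
expression in `V`, `U` and further independent randomness. -/
lemma identDistrib_resample {E F : Type*} [MeasurableSpace E] [MeasurableSpace F] {U V : Ω → E}
    {Ψ : E → Ω' → F} (hU : Measurable U) (hV : Measurable V) (hΨ : Measurable (Function.uncurry Ψ))
    (hUV : IndepFun U V P) :
    IdentDistrib (fun q : (Ω × Ω') × Ω => (Ψ (U q.1.1) q.1.2, V q.1.1))
      (fun q : (Ω × Ω') × Ω => (Ψ (U q.1.1) q.1.2, V q.2))
      ((P.prod Q).prod P) ((P.prod Q).prod P) := by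
  have hB : Measurable fun q : Ω × Ω' => Ψ (U q.1) q.2 :=
    hΨ.comp ((hU.comp measurable_fst).prodMk measurable_snd)
  have m1 : Measurable fun q : (Ω × Ω') × Ω => (Ψ (U q.1.1) q.1.2, V q.1.1) :=
    (hB.comp measurable_fst).prodMk (hV.comp (measurable_fst.comp measurable_fst))
  have m2 : Measurable fun q : (Ω × Ω') × Ω => (Ψ (U q.1.1) q.1.2, V q.2) :=
    (hB.comp measurable_fst).prodMk (hV.comp measurable_snd)
  refine ⟨m1.aemeasurable, m2.aemeasurable, Measure.ext_of_lintegral _ fun f hf => ?_⟩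
  have hf1 : Measurable fun q : (Ω × Ω') × Ω => f (Ψ (U q.1.1) q.1.2, V q.1.1) := hf.comp m1
  have hf2 : Measurable fun q : (Ω × Ω') × Ω => f (Ψ (U q.1.1) q.1.2, V q.2) := hf.comp m2
  rw [lintegral_map hf m1, lintegral_map hf m2, lintegral_prod _ hf1.aemeasurable,
    lintegral_prod _ hf2.aemeasurable]
  have m3 : Measurable fun q : Ω × Ω' => f (Ψ (U q.1) q.2, V q.1) :=
    hf.comp (hB.prodMk (hV.comp measurable_fst))
  have m4 : Measurable fun q : Ω × Ω' => ∫⁻ ω', f (Ψ (U q.1) q.2, V ω') ∂P :=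
    hf2.lintegral_prod_right'
  simp only [lintegral_const, measure_univ, mul_one]
  rw [lintegral_prod_symm _ m3.aemeasurable, lintegral_prod_symm _ m4.aemeasurable]
  refine lintegral_congr fun g => ?_
  -- for fixed outer randomness this is the product structure of the joint law
  have m5 : Measurable fun w : E × E => f (Ψ w.1 g, w.2) :=
    hf.comp ((hΨ.comp (measurable_fst.prodMk measurable_const)).prodMk measurable_snd)
  have hmap : P.map (fun ω => (U ω, V ω)) = (P.prod P).map (Prod.map U V) := by
    rw [(indepFun_iff_map_prod_eq_prod_map_map hU.aemeasurable hV.aemeasurable).mp hUV,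
      Measure.map_prod_map P P hU hV]
  have e := congrArg (fun μ => ∫⁻ w, f (Ψ w.1 g, w.2) ∂μ) hmap
  beta_reduce at e
  have m6 : Measurable fun q : Ω × Ω => f (Ψ (U q.1) g, V q.2) := m5.comp (hU.prodMap hV)
  rw [lintegral_map m5 (hU.prodMk hV), lintegral_map m5 (hU.prodMap hV)] at e
  exact e.trans (lintegral_prod _ m6.aemeasurable)

end Resampling

/-! ### The interpolation -/

/-- The matrix `Z₀ + s ∑ Zᵢ + c H`, with `H` independent of the `Zᵢ`. -/
def interp {Ω Ω' : Type*} {n : ℕ} (Z₀ : Matrix (Fin d) (Fin d) ℂ)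
    (Z : Fin n → Ω → Matrix (Fin d) (Fin d) ℂ)
    (H : Ω' → Matrix (Fin d) (Fin d) ℂ) (s c : ℝ) (q : Ω × Ω') : Matrix (Fin d) (Fin d) ℂ :=
  Z₀ + s • ∑ i, Z i q.1 + c • H q.2

lemma isHermitian_interp {Ω Ω' : Type*} {n : ℕ} {Z₀ : Matrix (Fin d) (Fin d) ℂ}
    {Z : Fin n → Ω → Matrix (Fin d) (Fin d) ℂ} {H : Ω' → Matrix (Fin d) (Fin d) ℂ}
    (hZ₀ : Z₀.IsHermitian) (hZ : ∀ i ω, (Z i ω).IsHermitian)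
    (hH : ∀ ω, (H ω).IsHermitian) (s c : ℝ) (q : Ω × Ω') : (interp Z₀ Z H s c q).IsHermitian :=
  (hZ₀.add (isHermitian_smul_real (isHermitian_sum (fun i => hZ i q.1) _) s)).add
    (isHermitian_smul_real (hH q.2) c)

section Interpolation

variable {Ω Ω' : Type*} [MeasurableSpace Ω] [MeasurableSpace Ω'] {P : Measure Ω} {Q : Measure Ω'}
  {n p : ℕ} {Z₀ : Matrix (Fin d) (Fin d) ℂ} {Z : Fin n → Ω → Matrix (Fin d) (Fin d) ℂ}
  {H : Ω' → Matrix (Fin d) (Fin d) ℂ} {z : ℂ} {R : ℝ}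

lemma measurable_interp (hZ : ∀ i, Measurable (Z i)) (hH : Measurable H) (s c : ℝ) :
    Measurable (interp Z₀ Z H s c) := by
  have h1 : Measurable fun q : Ω × Ω' => ∑ i, Z i q.1 :=
    Finset.measurable_fun_sum _ fun i _ => (hZ i).comp measurable_fst
  exact ((h1.const_smul s).const_add Z₀).add ((hH.comp measurable_snd).const_smul c)

lemma measurable_uncurry_affine (Z₀ : Matrix (Fin d) (Fin d) ℂ) (hH : Measurable H) (s c : ℝ) :
    Measurable (Function.uncurry fun (M : Matrix (Fin d) (Fin d) ℂ) (g : Ω') =>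
      Z₀ + s • M + c • H g) :=
  ((measurable_fst.const_smul s).const_add Z₀).add ((hH.comp measurable_snd).const_smul c)

lemma indepFun_sum_erase [DecidableEq (Fin n)] (hZ : ∀ i, Measurable (Z i))
    (hind : iIndepFun (fun i ω (a b : Fin d) => Z i ω a b) P) (i : Fin n) :
    IndepFun (fun ω => ∑ j ∈ Finset.univ.erase i, Z j ω) (Z i) P := by
  have h := hind.indepFun_finsetSum_of_notMem (s := Finset.univ.erase i) (i := i)
    (fun j => hZ j) (Finset.notMem_erase i _)
  have e : (fun ω => ∑ j ∈ Finset.univ.erase i, Z j ω) =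
      ∑ j ∈ Finset.univ.erase i, fun ω (a b : Fin d) => Z j ω a b := by
    funext ω a b
    simp only [Matrix.sum_apply, Finset.sum_apply]
  rw [e]
  exact h

variable [NeZero d] [IsProbabilityMeasure P] [IsProbabilityMeasure Q]

lemma integrable_powTraceD2_resampled (hZ : ∀ i, IsSARandomMatrix (Z i))
    (hL2 : ∀ i a b, MemLp (fun ω => Z i ω a b) 2 P) (hZ₀ : Z₀.IsHermitian) (hH : Measurable H)
    (hHh : ∀ ω, (H ω).IsHermitian) (hz : 0 < z.im) (s c : ℝ) (i : Fin n) :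
    Integrable (fun q : (Ω × Ω') × Ω => powTraceD2 z p (interp Z₀ Z H s c q.1) (Z i q.2) (Z i q.2))
      ((P.prod Q).prod P) := by
  have h2 := (memLp_of_entries (hZ i).measurable (hL2 i)).norm
  have hm : Measurable fun q : (Ω × Ω') × Ω => Z i q.2 :=
    (hZ i).measurable.comp measurable_snd
  exact integrable_powTraceD2
    ((measurable_interp (fun i => (hZ i).measurable) hH s c).comp measurable_fst)
    (fun q => isHermitian_interp hZ₀ (fun i => (hZ i).isHermitian) hHh s c q.1) hz hm hm
    ((h2.integrable_mul h2).comp_snd (P.prod Q))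

/-- The Gaussian part of the derivative of the interpolation, expressed through independent copies
of the summands. -/
lemma integral_powTraceD1_gaussian_eq_sum (hZ : ∀ i, IsSARandomMatrix (Z i))
    (hL2 : ∀ i a b, MemLp (fun ω => Z i ω a b) 2 P) (hZ₀ : Z₀.IsHermitian) (hH : Measurable H)
    (hHh : ∀ ω, (H ω).IsHermitian) (hG : HasGaussianLaw (fun ω (a b : Fin d) => H ω a b) Q)
    (hH0 : ∀ a b, ∫ ω, H ω a b ∂Q = 0) (hH2 : ∀ a b, MemLp (fun ω => H ω a b) 2 Q)
    (hcov : ∀ x y : Fin d × Fin d, ∫ ω, H ω x.1 x.2 * H ω y.1 y.2 ∂Q =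
      ∑ i, ∫ ω, Z i ω x.1 x.2 * Z i ω y.1 y.2 ∂P) (hz : 0 < z.im) (s c : ℝ) :
    ∫ q, powTraceD1 z p (interp Z₀ Z H s c q) (H q.2) ∂(P.prod Q) =
      c * ∑ i, ∫ q : (Ω × Ω') × Ω, powTraceD2 z p (interp Z₀ Z H s c q.1) (Z i q.2) (Z i q.2)
        ∂((P.prod Q).prod P) := by
  have hHL2 := memLp_of_entries hH hH2
  have hHi : Integrable H Q := hHL2.integrable one_le_two
  have hHH : Integrable (fun ω => ‖H ω‖ * ‖H ω‖) Q := hHL2.norm.integrable_mul hHL2.norm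
  have hH0' : ∫ ω, H ω ∂Q = 0 := by
    ext a b
    rw [integral_apply_entry hHi, hH0]; rfl
  have hSm := measurable_interp (Z₀ := Z₀) (fun i => (hZ i).measurable) hH s c
  have hSh := isHermitian_interp hZ₀ (fun i => (hZ i).isHermitian) hHh s c
  have hJ := integrable_powTraceD2_resampled (p := p) (Q := Q) hZ hL2 hZ₀ hH hHh hz s c
  have i1 : Integrable (fun q : Ω × Ω' => powTraceD1 z p (interp Z₀ Z H s c q) (H q.2))
      (P.prod Q) :=
    integrable_powTraceD1 hSm hSh hz (hH.comp measurable_snd) (hHi.norm.comp_snd P)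
  have i2 : Integrable (fun q : Ω × Ω' => ∑ i, ∫ ω', powTraceD2 z p (interp Z₀ Z H s c q)
      (Z i ω') (Z i ω') ∂P) (P.prod Q) :=
    integrable_finsetSum _ fun i _ => (hJ i).integral_prod_left
  have e1 : ∀ ω, ∫ g, powTraceD1 z p (interp Z₀ Z H s c (ω, g)) (H g) ∂Q =
      c * ∫ g, ∑ i, ∫ ω', powTraceD2 z p (interp Z₀ Z H s c (ω, g)) (Z i ω') (Z i ω') ∂P ∂Q := by
    intro ω
    have hX : (Z₀ + s • ∑ i, Z i ω).IsHermitian :=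
      hZ₀.add (isHermitian_smul_real (isHermitian_sum (fun i => (hZ i).isHermitian ω) _) s)
    have h1 := integral_powTraceD1_gaussian (p := p) hH hHh hG hH0 hHi hH0' hHH hX hz c
    have i3 : Integrable (fun q : Ω' × Ω' => powTraceD2 z p (Z₀ + s • ∑ i, Z i ω + c • H q.1)
        (H q.2) (H q.2)) (Q.prod Q) :=
      integrable_powTraceD2 (((hH.comp measurable_fst).const_smul c).const_add _)
        (fun q => hX.add (isHermitian_smul_real (hHh q.1) c)) hz (hH.comp measurable_snd)
        (hH.comp measurable_snd) (hHH.comp_snd Q)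
    rw [integral_prod _ i3] at h1
    refine h1.trans ?_
    congr 1
    refine integral_congr_ae (.of_forall fun g => ?_)
    simp only [powTraceD2_eq_re_form]
    exact integral_re_bilin_eq_sum hH2 hL2 hcov _
  rw [integral_prod _ i1]
  simp only [e1]
  rw [integral_const_mul, ← integral_prod _ i2,
    integral_finsetSum _ fun i _ => (hJ i).integral_prod_left]
  congr 1
  exact Finset.sum_congr rfl fun i _ => (integral_prod _ (hJ i)).symm

/-- The third-order remainder contributed by the `i`-th summand. -/
lemma abs_integral_sub_le_of_summand (hp : 1 ≤ p) (hZ : ∀ i, IsSARandomMatrix (Z i))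
    (hZi : ∀ i, Integrable (Z i) P) (h0 : ∀ i, expect P (Z i) = 0)
    (hind : iIndepFun (fun i ω (a b : Fin d) => Z i ω a b) P)
    (hZ₀ : Z₀.IsHermitian) (hH : Measurable H) (hHh : ∀ ω, (H ω).IsHermitian)
    (hR : ∀ i, ∀ᵐ ω ∂P, ‖Z i ω‖ ≤ R)
    (hz : 0 < z.im) (hε : p * R * z.im⁻¹ ≤ 1 / 6) {s : ℝ} (hs1 : |s| ≤ 1) (c : ℝ) (i : Fin n) :
    |∫ q, powTraceD1 z p (interp Z₀ Z H s c q) (Z i q.1) ∂(P.prod Q) -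
        s * ∫ q : (Ω × Ω') × Ω, powTraceD2 z p (interp Z₀ Z H s c q.1) (Z i q.2) (Z i q.2)
          ∂((P.prod Q).prod P)| ≤ 2016 * p ^ 3 * R * z.im⁻¹ ^ 3 *
      ∫ q : (Ω × Ω') × Ω, hs (res z (interp Z₀ Z H s c q.1) ^ p * Z i q.2) ^ 2
        ∂((P.prod Q).prod P) := by
  classical
  have hZm : ∀ i, Measurable (Z i) := fun i => (hZ i).measurable
  have hZh : ∀ i ω, (Z i ω).IsHermitian := fun i => (hZ i).isHermitian
  have hSm := measurable_interp (Z₀ := Z₀) hZm hH s c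
  have hSh := isHermitian_interp hZ₀ hZh hHh s c
  have hY : Measurable fun q : (Ω × Ω') × Ω => Z i q.1.1 :=
    (hZm i).comp (measurable_fst.comp measurable_fst)
  have hY' : Measurable fun q : (Ω × Ω') × Ω => Z i q.2 := (hZm i).comp measurable_snd
  have hR1 : ∀ᵐ q : (Ω × Ω') × Ω ∂((P.prod Q).prod P), ‖Z i q.1.1‖ ≤ R :=
    (Measure.quasiMeasurePreserving_fst.comp Measure.quasiMeasurePreserving_fst).ae (hR i)
  have hR2 : ∀ᵐ q : (Ω × Ω') × Ω ∂((P.prod Q).prod P), ‖Z i q.2‖ ≤ R :=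
    Measure.quasiMeasurePreserving_snd.ae (hR i)
  -- the sum with the `i`-th summand removed
  set U : Ω → Matrix (Fin d) (Fin d) ℂ := fun ω => ∑ j ∈ Finset.univ.erase i, Z j ω with hU
  have hUm : Measurable U := Finset.measurable_fun_sum _ fun j _ => hZm j
  have hΨm := measurable_uncurry_affine Z₀ hH s c
  have hBm : Measurable fun q : (Ω × Ω') × Ω => Z₀ + s • U q.1.1 + c • H q.1.2 :=
    (((hUm.comp (measurable_fst.comp measurable_fst)).const_smul s).const_add Z₀).add
      ((hH.comp (measurable_snd.comp measurable_fst)).const_smul c)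
  have hBh : ∀ q : (Ω × Ω') × Ω, (Z₀ + s • U q.1.1 + c • H q.1.2).IsHermitian := fun q =>
    (hZ₀.add (isHermitian_smul_real (isHermitian_sum (fun j => hZh j q.1.1) _) s)).add
      (isHermitian_smul_real (hHh q.1.2) c)
  have hBS : ∀ q : (Ω × Ω') × Ω, Z₀ + s • U q.1.1 + c • H q.1.2 + s • Z i q.1.1 =
      interp Z₀ Z H s c q.1 := by
    intro q
    rw [interp, ← Finset.sum_erase_add _ _ (Finset.mem_univ i), smul_add]
    abel
  have hmean : ∫ q : (Ω × Ω') × Ω, powTraceD1 z p (Z₀ + s • U q.1.1 + c • H q.1.2) (Z i q.2)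
      ∂((P.prod Q).prod P) = 0 := by
    rw [integral_prod _ (integrable_powTraceD1 hBm hBh hz hY' ((hZi i).norm.comp_snd (P.prod Q)))]
    have h2 : ∫ ω, Z i ω ∂P = 0 := by rw [← expect_eq_integral (hZi i), h0]
    have h3 : ∀ q : Ω × Ω', ∫ ω', powTraceD1 z p (Z₀ + s • U q.1 + c • H q.2) (Z i ω') ∂P = 0 :=
      fun q => integral_powTraceD1_eq_zero _ (hZi i) h2
    simp only [h3, integral_zero]
  have hid := identDistrib_resample (Q := Q) hUm (hZm i) hΨm
    (indepFun_sum_erase hZm hind i)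
  have main := abs_integral_powTraceD1_sub_le (t := s) hp hBm hY hY' hBh (fun q => hZh i _)
    (fun q => hZh i _) hR1 hR2 hid hmean hz hε hs1
  simp only [hBS] at main
  have e : ∫ q : (Ω × Ω') × Ω, powTraceD1 z p (interp Z₀ Z H s c q.1) (Z i q.1.1)
      ∂((P.prod Q).prod P) =
      ∫ q, powTraceD1 z p (interp Z₀ Z H s c q) (Z i q.1) ∂(P.prod Q) := by
    have i1 : Integrable (fun q : Ω × Ω' => powTraceD1 z p (interp Z₀ Z H s c q) (Z i q.1))
        (P.prod Q) :=
      integrable_powTraceD1 hSm hSh hz ((hZm i).comp measurable_fst) ((hZi i).norm.comp_fst Q)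
    rw [integral_prod _ (i1.comp_fst P)]
    simp only [integral_const, probReal_univ, one_smul]
  rwa [e] at main

/-- The two contributions to the derivative of the interpolation cancel up to the third-order
terms. -/
lemma abs_sum_integral_sub_le (hp : 1 ≤ p) (hZ : ∀ i, IsSARandomMatrix (Z i))
    (hL2 : ∀ i a b, MemLp (fun ω => Z i ω a b) 2 P) (h0 : ∀ i, expect P (Z i) = 0)
    (hind : iIndepFun (fun i ω (a b : Fin d) => Z i ω a b) P)
    (hZ₀ : Z₀.IsHermitian) (hH : Measurable H) (hHh : ∀ ω, (H ω).IsHermitian)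
    (hR0 : 0 ≤ R) (hR : ∀ i, ∀ᵐ ω ∂P, ‖Z i ω‖ ≤ R)
    (hz : 0 < z.im) (hε : p * R * z.im⁻¹ ≤ 1 / 6) {s : ℝ} (hs1 : |s| ≤ 1) (c : ℝ) :
    |∑ i, ∫ q, powTraceD1 z p (interp Z₀ Z H s c q) (Z i q.1) ∂(P.prod Q) -
        s * ∑ i, ∫ q : (Ω × Ω') × Ω, powTraceD2 z p (interp Z₀ Z H s c q.1) (Z i q.2) (Z i q.2)
          ∂((P.prod Q).prod P)| ≤
      2016 * p ^ 3 * R * z.im⁻¹ ^ 3 * sigma P (model Z₀ Z) ^ 2 *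
        ∫ q, powTrace z p (interp Z₀ Z H s c q) ∂(P.prod Q) := by
  have hZm : ∀ i, Measurable (Z i) := fun i => (hZ i).measurable
  have hZh : ∀ i ω, (Z i ω).IsHermitian := fun i => (hZ i).isHermitian
  have hSm := measurable_interp (Z₀ := Z₀) hZm hH s c
  have hSh := isHermitian_interp hZ₀ hZh hHh s c
  have hZi : ∀ i, Integrable (Z i) P := fun i =>
    (memLp_of_entries (hZm i) (hL2 i)).integrable one_le_two
  have hR2 : ∀ i, ∀ᵐ q : (Ω × Ω') × Ω ∂((P.prod Q).prod P), ‖Z i q.2‖ ≤ R := fun i =>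
    Measure.quasiMeasurePreserving_snd.ae (hR i)
  have hj : ∀ i, Integrable (fun q : (Ω × Ω') × Ω =>
      hs (res z (interp Z₀ Z H s c q.1) ^ p * Z i q.2) ^ 2) ((P.prod Q).prod P) := fun i =>
    integrable_hs_res_pow_mul_sq (hSm.comp measurable_fst) (fun q => hSh q.1) hz
      ((hZm i).comp measurable_snd) (hR2 i)
  have key := abs_integral_sub_le_of_summand (Q := Q) hp hZ hZi h0 hind hZ₀ hH hHh hR hz hε hs1 c
  have hsum : ∑ i, ∫ q : (Ω × Ω') × Ω, hs (res z (interp Z₀ Z H s c q.1) ^ p * Z i q.2) ^ 2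
      ∂((P.prod Q).prod P) ≤ sigma P (model Z₀ Z) ^ 2 *
        ∫ q, powTrace z p (interp Z₀ Z H s c q) ∂(P.prod Q) := by
    simp only [fun i => integral_prod _ (hj i)]
    rw [← integral_finsetSum _ fun i _ => (hj i).integral_prod_left, ← integral_const_mul]
    refine integral_mono (integrable_finsetSum _ fun i _ => (hj i).integral_prod_left)
      ((integrable_powTrace hSm hSh hz).const_mul _) fun q => ?_
    simp only [powTrace_eq_hs_sq (hSh q)]
    exact sum_integral_hs_mul_sq_le hZ hL2 h0 hind _
  rw [Finset.mul_sum, ← Finset.sum_sub_distrib]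
  refine (Finset.abs_sum_le_sum_abs _ _).trans ((Finset.sum_le_sum fun i _ => key i).trans ?_)
  rw [← Finset.mul_sum, mul_assoc (2016 * (p : ℝ) ^ 3 * R * z.im⁻¹ ^ 3)]
  exact mul_le_mul_of_nonneg_left hsum (by positivity)

/-- The derivative of the interpolation: the velocity of the interpolating matrix is
`cos θ ∑ Zᵢ - sin θ H`. -/
lemma hasDerivAt_integral_powTrace_interp (hZ : ∀ i, IsSARandomMatrix (Z i))
    (hL2 : ∀ i a b, MemLp (fun ω => Z i ω a b) 2 P) (hZ₀ : Z₀.IsHermitian) (hH : Measurable H)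
    (hHh : ∀ ω, (H ω).IsHermitian) (hH2 : ∀ a b, MemLp (fun ω => H ω a b) 2 Q) (hz : 0 < z.im)
    (θ : ℝ) :
    HasDerivAt
      (fun t => ∫ q, powTrace z p (interp Z₀ Z H (Real.sin t) (Real.cos t) q) ∂(P.prod Q))
      (Real.cos θ * ∑ i, ∫ q, powTraceD1 z p (interp Z₀ Z H (Real.sin θ) (Real.cos θ) q) (Z i q.1)
          ∂(P.prod Q) -
        Real.sin θ * ∫ q, powTraceD1 z p (interp Z₀ Z H (Real.sin θ) (Real.cos θ) q) (H q.2)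
          ∂(P.prod Q)) θ := by
  have hZm : ∀ i, Measurable (Z i) := fun i => (hZ i).measurable
  have hZh : ∀ i ω, (Z i ω).IsHermitian := fun i => (hZ i).isHermitian
  have hSm := fun t => measurable_interp (Z₀ := Z₀) hZm hH (Real.sin t) (Real.cos t)
  have hSh := fun t => isHermitian_interp hZ₀ hZh hHh (Real.sin t) (Real.cos t)
  have hHi : Integrable H Q := (memLp_of_entries hH hH2).integrable one_le_two
  have hZi : ∀ i, Integrable (Z i) P := fun i =>
    (memLp_of_entries (hZm i) (hL2 i)).integrable one_le_two
  let W : Ω → Matrix (Fin d) (Fin d) ℂ := fun ω => ∑ i, Z i ω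
  have hWm : Measurable W := Finset.measurable_fun_sum _ fun i _ => hZm i
  have hWi : Integrable W P := integrable_finsetSum _ fun i _ => hZi i
  have hWh : ∀ ω, (W ω).IsHermitian := fun ω => isHermitian_sum (fun i => hZh i ω) _
  let V : ℝ → Ω × Ω' → Matrix (Fin d) (Fin d) ℂ := fun t q =>
    Real.cos t • W q.1 + (-Real.sin t) • H q.2
  have hVm : ∀ t, Measurable (V t) := fun t =>
    measurable_real_combination (hWm.comp measurable_fst) (hH.comp measurable_snd) _ _
  have hVh : ∀ t q, (V t q).IsHermitian := fun t q =>
    isHermitian_real_combination (hWh q.1) (hHh q.2) _ _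
  have hd : ∀ t q, HasDerivAt (fun t => interp Z₀ Z H (Real.sin t) (Real.cos t) q) (V t q) t :=
    fun t q => (((Real.hasDerivAt_sin t).smul_const (W q.1)).const_add Z₀).add
      ((Real.hasDerivAt_cos t).smul_const (H q.2))
  have hbi : Integrable (fun q : Ω × Ω' => 2 * p * d * z.im⁻¹ ^ (2 * p + 1) *
      (‖W q.1‖ + ‖H q.2‖)) (P.prod Q) :=
    ((hWi.norm.comp_fst Q).add (hHi.norm.comp_snd P)).const_mul _
  have hb : ∀ t q, ‖powTraceD1 z p (interp Z₀ Z H (Real.sin t) (Real.cos t) q) (V t q)‖ ≤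
      2 * p * d * z.im⁻¹ ^ (2 * p + 1) * (‖W q.1‖ + ‖H q.2‖) := fun t q =>
    (abs_powTraceD1_le (hSh t q) hz _).trans (mul_le_mul_of_nonneg_left
      (norm_cos_smul_add_sin_smul_le _ _ _ _ (Real.abs_cos_le_one t)
        (by rw [abs_neg]; exact Real.abs_sin_le_one t)) (by positivity))
  have key := (hasDerivAt_integral_of_dominated_loc_of_deriv_le (s := Set.univ) (x₀ := θ)
      (F := fun t q => powTrace z p (interp Z₀ Z H (Real.sin t) (Real.cos t) q))
      (F' := fun t q => powTraceD1 z p (interp Z₀ Z H (Real.sin t) (Real.cos t) q) (V t q))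
      Filter.univ_mem
      (.of_forall fun t => (measurable_powTrace z p (hSm t)).aestronglyMeasurable)
      (integrable_powTrace (hSm θ) (hSh θ) hz)
      (measurable_powTraceD1 z p (hSm θ) (hVm θ)).aestronglyMeasurable
      (.of_forall fun q t _ => hb t q) hbi
      (.of_forall fun q t _ => hasDerivAt_powTrace hz (hSh t q) (hVh t q) (hd t q))).2
  refine key.congr_deriv ?_
  have i1 : ∀ i, Integrable (fun q : Ω × Ω' =>
      powTraceD1 z p (interp Z₀ Z H (Real.sin θ) (Real.cos θ) q) (Z i q.1)) (P.prod Q) := fun i =>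
    integrable_powTraceD1 (hSm θ) (hSh θ) hz ((hZm i).comp measurable_fst)
      ((hZi i).norm.comp_fst Q)
  have i2 : Integrable (fun q : Ω × Ω' =>
      powTraceD1 z p (interp Z₀ Z H (Real.sin θ) (Real.cos θ) q) (H q.2)) (P.prod Q) :=
    integrable_powTraceD1 (hSm θ) (hSh θ) hz (hH.comp measurable_snd) (hHi.norm.comp_snd P)
  simp only [V, W, powTraceD1_add, powTraceD1_smul, powTraceD1_sum]
  rw [integral_add ((integrable_finsetSum _ fun i _ => i1 i).const_mul _) (i2.const_mul _),
    integral_const_mul, integral_const_mul, integral_finsetSum _ fun i _ => i1 i]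
  ring

end Interpolation

/-! ### Moments of the resolvent -/

/-- The trace of the even negative power of the modulus is a polynomial in the resolvent and its
adjoint, because the modulus enters through its square only. -/
lemma re_ntr_modulus_zpow (z : ℂ) (p : ℕ) {Y : Matrix (Fin d) (Fin d) ℂ} (hY : Y.IsHermitian) :
    (ntr (modulus (z • 1 - Y) ^ (-(2 * (p : ℤ))))).re = (d : ℝ)⁻¹ * powTrace z p Y := by
  have h1 : modulus (z • 1 - Y) ^ (-(2 * (p : ℤ))) = res z Y ^ p * (res z Y)ᴴ ^ p := by
    rw [show (2 * (p : ℤ)) = ((2 * p : ℕ) : ℤ) by push_cast; rfl, Matrix.zpow_neg_natCast,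
      pow_mul, pow_two, modulus_mul_modulus, ← Matrix.inv_pow', Matrix.mul_inv_rev,
      ← Matrix.conjTranspose_nonsing_inv]
    exact (commute_res z hY).mul_pow p
  rw [ntr, h1, powTrace, show ((d : ℂ)⁻¹) = (((d : ℝ)⁻¹ : ℝ) : ℂ) by push_cast; rfl,
    Complex.re_ofReal_mul]

lemma resolventMoment_eq {T : Type*} [MeasurableSpace T] (μ : Measure T)
    {Y : T → Matrix (Fin d) (Fin d) ℂ} (hY : ∀ ω, (Y ω).IsHermitian) (z : ℂ) (p : ℕ) :
    resolventMoment μ Y z p =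
      ((d : ℝ)⁻¹ * ∫ ω, powTrace z p (Y ω) ∂μ) ^ (1 / (2 * (p : ℝ))) := by
  rw [resolventMoment]
  simp only [fun ω => re_ntr_modulus_zpow z p (hY ω)]
  rw [integral_const_mul]

section

variable [NeZero d] {T : Type*} [MeasurableSpace T] {μ : Measure T} [IsProbabilityMeasure μ]
  {Y : T → Matrix (Fin d) (Fin d) ℂ} {z : ℂ} {p : ℕ}

lemma integral_powTrace_le (hYm : Measurable Y) (hY : ∀ ω, (Y ω).IsHermitian) (hz : 0 < z.im) :
    (d : ℝ)⁻¹ * ∫ ω, powTrace z p (Y ω) ∂μ ≤ z.im⁻¹ ^ (2 * p) := by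
  have hd : (0 : ℝ) < d := by exact_mod_cast Nat.pos_of_ne_zero (NeZero.ne d)
  rw [inv_mul_le_iff₀ hd]
  have h := integral_mono (integrable_powTrace (μ := μ) (p := p) hYm hY hz)
    (integrable_const (d * z.im⁻¹ ^ (2 * p))) fun ω => powTrace_le (hY ω) hz
  simpa using h

lemma integral_powTrace_pos (hYm : Measurable Y) (hY : ∀ ω, (Y ω).IsHermitian) (hz : 0 < z.im) :
    0 < ∫ ω, powTrace z p (Y ω) ∂μ := by
  rw [integral_pos_iff_support_of_nonneg (fun ω => powTrace_nonneg (hY ω))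
    (integrable_powTrace hYm hY hz)]
  have h : Function.support (fun ω => powTrace z p (Y ω)) = Set.univ := by
    ext ω
    simp [(powTrace_pos (p := p) (hY ω) hz).ne']
  rw [h, measure_univ]
  exact zero_lt_one

lemma rpow_le_of_le_pow {x y : ℝ} (hp : 1 ≤ p) (hx : 0 ≤ x) (hy : 0 ≤ y) (h : x ≤ y ^ (2 * p)) :
    x ^ (1 / (2 * (p : ℝ))) ≤ y := by
  have h1 := Real.rpow_le_rpow hx h (by positivity : (0 : ℝ) ≤ 1 / (2 * (p : ℝ)))
  have h2 : (y ^ (2 * p)) ^ (1 / (2 * (p : ℝ))) = y := by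
    rw [show 1 / (2 * (p : ℝ)) = ((2 * p : ℕ) : ℝ)⁻¹ by push_cast; rw [one_div]]
    exact Real.pow_rpow_inv_natCast hy (by omega)
  rwa [h2] at h1

lemma resolventMoment_nonneg_and_le (hp : 1 ≤ p) (hYm : Measurable Y)
    (hY : ∀ ω, (Y ω).IsHermitian) (hz : 0 < z.im) :
    0 ≤ resolventMoment μ Y z p ∧ resolventMoment μ Y z p ≤ z.im⁻¹ := by
  rw [resolventMoment_eq μ hY]
  have h0 : 0 ≤ (d : ℝ)⁻¹ * ∫ ω, powTrace z p (Y ω) ∂μ :=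
    mul_nonneg (by positivity) (integral_nonneg fun ω => powTrace_nonneg (hY ω))
  exact ⟨Real.rpow_nonneg h0 _, rpow_le_of_le_pow hp h0 (by positivity)
    (integral_powTrace_le hYm hY hz)⟩

end

/-- A differential inequality `|φ'| ≤ L φ` makes `φ ^ (1 / 2p)` Lipschitz when `φ` is bounded. -/
lemma abs_rpow_sub_rpow_le {φ φ' : ℝ → ℝ} {L M : ℝ} {p : ℕ} (hp : 1 ≤ p) (hM : 0 ≤ M)
    (hpos : ∀ t, 0 < φ t) (hle : ∀ t, φ t ≤ M ^ (2 * p)) (hd : ∀ t, HasDerivAt φ (φ' t) t)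
    (hL : ∀ t, |φ' t| ≤ L * φ t) (a b : ℝ) :
    |φ b ^ (1 / (2 * (p : ℝ))) - φ a ^ (1 / (2 * (p : ℝ)))| ≤ L / (2 * p) * M * |b - a| := by
  have hL0 : 0 ≤ L := by
    have := (abs_nonneg _).trans (hL 0)
    exact nonneg_of_mul_nonneg_left this (hpos 0)
  have hder : ∀ t, HasDerivAt (fun t => φ t ^ (1 / (2 * (p : ℝ))))
      (φ' t * (1 / (2 * (p : ℝ))) * φ t ^ (1 / (2 * (p : ℝ)) - 1)) t := fun t =>
    (hd t).rpow_const (Or.inl (hpos t).ne')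
  have hbound : ∀ t, ‖φ' t * (1 / (2 * (p : ℝ))) * φ t ^ (1 / (2 * (p : ℝ)) - 1)‖ ≤
      L / (2 * p) * M := by
    intro t
    have hφ := hpos t
    rw [norm_mul, norm_mul, Real.norm_eq_abs, Real.norm_of_nonneg (by positivity),
      Real.norm_of_nonneg (by positivity)]
    calc _ ≤ L * φ t * (1 / (2 * (p : ℝ))) * φ t ^ (1 / (2 * (p : ℝ)) - 1) := by
          gcongr
          exact hL t
      _ = L / (2 * p) * φ t ^ (1 / (2 * (p : ℝ))) := by
          rw [Real.rpow_sub_one hφ.ne']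
          field_simp
      _ ≤ _ := by
          gcongr
          exact rpow_le_of_le_pow hp hφ.le hM (hle t)
  have := convex_univ.norm_image_sub_le_of_norm_hasDerivWithin_le
    (fun t _ => (hder t).hasDerivWithinAt) (fun t _ => hbound t) (Set.mem_univ a) (Set.mem_univ b)
  simpa only [Real.norm_eq_abs] using this

/-! ### Comparison of the moments -/

section

variable {Ω Ω' : Type*} [MeasurableSpace Ω] [MeasurableSpace Ω'] {P : Measure Ω} {Q : Measure Ω'}
  {n p : ℕ} {Z₀ : Matrix (Fin d) (Fin d) ℂ} {Z : Fin n → Ω → Matrix (Fin d) (Fin d) ℂ}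
  {G : Ω' → Matrix (Fin d) (Fin d) ℂ} {z : ℂ} {R : ℝ}

lemma ae_norm_le_of_Rparam (h : Rparam P Z ≠ ∞) (i : Fin n) :
    ∀ᵐ ω ∂P, ‖Z i ω‖ ≤ (Rparam P Z).toReal := by
  have h1 := ae_le_eLpNormEssSup (f := fun ω => ⨆ i, specNorm (Z i ω)) (μ := P)
  filter_upwards [h1] with ω hω
  have h2 : ‖⨆ i, specNorm (Z i ω)‖ ≤ (Rparam P Z).toReal := by
    have h3 := ENNReal.toReal_mono h (hω.trans_eq (eLpNorm_exponent_top).symm)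
    simpa using h3
  calc ‖Z i ω‖ = specNorm (Z i ω) := rfl
    _ ≤ ⨆ i, specNorm (Z i ω) :=
      le_ciSup (f := fun i => specNorm (Z i ω)) (Set.finite_range _).bddAbove i
    _ ≤ _ := (Real.le_norm_self _).trans h2

/-- The real and imaginary parts of the entries determine the matrix linearly, and translations
preserve Gaussian laws. -/
lemma hasGaussianLaw_centered
    (hG : HasGaussianLaw (fun ω (a : Fin d × Fin d) => ((G ω a.1 a.2).re, (G ω a.1 a.2).im)) Q)
    (M : Matrix (Fin d) (Fin d) ℂ) :
    HasGaussianLaw (fun ω (a b : Fin d) => (G ω - M) a b) Q := by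
  let L : (Fin d × Fin d → ℝ × ℝ) →ₗ[ℝ] (Fin d → Fin d → ℂ) :=
    { toFun := fun e a b => ((e (a, b)).1 : ℂ) + (e (a, b)).2 * Complex.I
      map_add' := fun e f => by ext a b; simp; ring
      map_smul' := fun c e => by ext a b; simp; ring }
  have h2 := hG.map (LinearMap.toContinuousLinearMap L)
  have e : (LinearMap.toContinuousLinearMap L ∘
      fun ω (a : Fin d × Fin d) => ((G ω a.1 a.2).re, (G ω a.1 a.2).im)) =
      fun ω (a b : Fin d) => G ω a b := by
    funext ω a b
    simp [L]
  rw [e] at h2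
  constructor
  have h3 := h2.isGaussian_map
  have e' : Q.map (fun ω (a b : Fin d) => (G ω - M) a b) =
      (Q.map (fun ω (a b : Fin d) => G ω a b)).map (fun Y => Y - fun a b => M a b) := by
    rw [AEMeasurable.map_map_of_aemeasurable (by fun_prop) h2.aemeasurable]
    rfl
  rw [e']
  infer_instance

variable [IsProbabilityMeasure P] [IsProbabilityMeasure Q]

/-- The quantitative comparison when the summands are small compared to the distance of `z` to the
real line. -/
lemma abs_resolventMoment_sub_le_of_small [NeZero d] (hp : 1 ≤ p)
    (hZ : ∀ i, IsSARandomMatrix (Z i))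
    (hL2 : ∀ i a b, MemLp (fun ω => Z i ω a b) 2 P) (h0 : ∀ i, expect P (Z i) = 0)
    (hind : iIndepFun (fun i ω (a b : Fin d) => Z i ω a b) P) (hZ₀ : Z₀.IsHermitian)
    (hG : IsGaussianModel P Q (model Z₀ Z) G) (hR0 : 0 ≤ R) (hR : ∀ i, ∀ᵐ ω ∂P, ‖Z i ω‖ ≤ R)
    (hz : 0 < z.im) (hε : p * R * z.im⁻¹ ≤ 1 / 6) :
    |resolventMoment P (model Z₀ Z) z p - resolventMoment Q G z p| ≤
      2016 * p ^ 2 * R * z.im⁻¹ ^ 4 * sigma P (model Z₀ Z) ^ 2 := by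
  have hZm : ∀ i, Measurable (Z i) := fun i => (hZ i).measurable
  have hZh : ∀ i ω, (Z i ω).IsHermitian := fun i => (hZ i).isHermitian
  set H : Ω' → Matrix (Fin d) (Fin d) ℂ := fun ω => G ω - Z₀ with hHdef
  have hGm : Measurable G := hG.saRandomMatrix.measurable
  have hH : Measurable H := hGm.sub_const Z₀
  have hHh : ∀ ω, (H ω).IsHermitian := fun ω => (hG.saRandomMatrix.isHermitian ω).sub hZ₀
  have hHG : HasGaussianLaw (fun ω (a b : Fin d) => H ω a b) Q :=
    hasGaussianLaw_centered hG.jointlyGaussian Z₀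
  have hHa : ∀ a, HasGaussianLaw (fun ω b => H ω a b) Q := fun a => hHG.eval a
  have hHab : ∀ a b, HasGaussianLaw (fun ω => H ω a b) Q := fun a b => (hHa a).eval b
  have hH2 : ∀ a b, MemLp (fun ω => H ω a b) 2 Q := fun a b => (hHab a b).memLp_two
  have hH0 : ∀ a b, ∫ ω, H ω a b ∂Q = 0 := by
    intro a b
    have hi : Integrable (fun ω => G ω a b) Q := by
      have h1 := (hHab a b).integrable.add (integrable_const (Z₀ a b))
      refine h1.congr (.of_forall fun ω => ?_)
      simp [hHdef]
    have h1 : ∫ ω, G ω a b ∂Q = Z₀ a b :=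
      congrFun (congrFun (hG.mean_eq.trans (expect_model hL2 h0)) a) b
    simp only [hHdef, Matrix.sub_apply]
    rw [integral_sub hi (integrable_const _), h1]
    simp
  have hcov := integral_mul_entries_gaussianModel hZ hL2 h0 hind hZ₀ hG
  have hSm := fun t => measurable_interp (Z₀ := Z₀) hZm hH (Real.sin t) (Real.cos t)
  have hSh := fun t => isHermitian_interp hZ₀ hZh hHh (Real.sin t) (Real.cos t)
  set φ : ℝ → ℝ := fun t =>
    ∫ q, powTrace z p (interp Z₀ Z H (Real.sin t) (Real.cos t) q) ∂(P.prod Q) with hφ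
  set L : ℝ := 2016 * p ^ 3 * R * z.im⁻¹ ^ 3 * sigma P (model Z₀ Z) ^ 2 with hL
  have hL0 : 0 ≤ L := by positivity
  have hd : (0 : ℝ) < d := by exact_mod_cast Nat.pos_of_ne_zero (NeZero.ne d)
  have hderiv : ∀ t, ∃ φ', HasDerivAt φ φ' t ∧ |φ'| ≤ L * φ t := by
    intro t
    refine ⟨_, hasDerivAt_integral_powTrace_interp hZ hL2 hZ₀ hH hHh hH2 hz t, ?_⟩
    rw [integral_powTraceD1_gaussian_eq_sum hZ hL2 hZ₀ hH hHh hHG hH0 hH2 hcov hz,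
      mul_left_comm (Real.sin t), ← mul_sub, abs_mul]
    exact (mul_le_of_le_one_left (abs_nonneg _) (Real.abs_cos_le_one t)).trans
      (abs_sum_integral_sub_le hp hZ hL2 h0 hind hZ₀ hH hHh hR0 hR hz hε (Real.abs_sin_le_one t) _)
  choose φ' hφ' hφL using hderiv
  have hmain := abs_rpow_sub_rpow_le (φ := fun t => (d : ℝ)⁻¹ * φ t)
    (φ' := fun t => (d : ℝ)⁻¹ * φ' t) (L := L) (M := z.im⁻¹) hp (by positivity)
    (fun t => mul_pos (by positivity) (integral_powTrace_pos (hSm t) (hSh t) hz))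
    (fun t => integral_powTrace_le (hSm t) (hSh t) hz) (fun t => (hφ' t).const_mul _)
    (fun t => by
      rw [abs_mul, abs_of_pos (by positivity : (0 : ℝ) < (d : ℝ)⁻¹), mul_left_comm]
      exact mul_le_mul_of_nonneg_left (hφL t) (by positivity)) 0 (Real.pi / 2)
  have e1 : φ (Real.pi / 2) = ∫ ω, powTrace z p (model Z₀ Z ω) ∂P := by
    have hm : Measurable (model Z₀ Z) :=
      (Finset.measurable_fun_sum _ fun i _ => hZm i).const_add Z₀
    have hh : ∀ ω, (model Z₀ Z ω).IsHermitian := fun ω =>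
      hZ₀.add (isHermitian_sum (fun i => hZh i ω) _)
    have hi : Integrable (fun q : Ω × Ω' => powTrace z p (model Z₀ Z q.1)) (P.prod Q) :=
      (integrable_powTrace hm hh hz).comp_fst Q
    simp only [hφ, interp, Real.sin_pi_div_two, Real.cos_pi_div_two, one_smul, zero_smul, add_zero]
    refine (integral_prod _ hi).trans ?_
    simp only [integral_const, probReal_univ, one_smul]
  have e0 : φ 0 = ∫ ω, powTrace z p (G ω) ∂Q := by
    have hi : Integrable (fun q : Ω × Ω' => powTrace z p (G q.2)) (P.prod Q) :=
      (integrable_powTrace hGm hG.saRandomMatrix.isHermitian hz).comp_snd P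
    simp only [hφ, interp, Real.sin_zero, Real.cos_zero, one_smul, zero_smul, add_zero, hHdef,
      add_sub_cancel]
    refine (integral_prod _ hi).trans ?_
    simp only [integral_const, probReal_univ, one_smul]
  have hXh : ∀ ω, (model Z₀ Z ω).IsHermitian := fun ω =>
    hZ₀.add (isHermitian_sum (fun i => hZh i ω) _)
  rw [resolventMoment_eq P hXh, resolventMoment_eq Q hG.saRandomMatrix.isHermitian, ← e1, ← e0]
  refine hmain.trans ?_
  -- the length of the interpolation interval cancels the factor `1 / 2` in the exponent
  have hpi : |Real.pi / 2 - 0| ≤ 2 := by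
    rw [sub_zero, abs_of_pos (by positivity)]
    linarith [Real.pi_le_four]
  have hp0 : (p : ℝ) ≠ 0 := by positivity
  calc _ ≤ L / (2 * p) * z.im⁻¹ * 2 := by gcongr
    _ = _ := by rw [hL]; field_simp

end

end ResolventUniversality

end

theorem mainTheorem4 :
    ∃ C : ℝ, 0 < C ∧
      ∀ (d n : ℕ), 2 ≤ d →
      ∀ (Ω Ω' : Type*) [MeasurableSpace Ω] [MeasurableSpace Ω']
        (P : Measure Ω) (Q : Measure Ω') [IsProbabilityMeasure P] [IsProbabilityMeasure Q]
        (Z₀ : Matrix (Fin d) (Fin d) ℂ) (Z : Fin n → Ω → Matrix (Fin d) (Fin d) ℂ)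
        (G : Ω' → Matrix (Fin d) (Fin d) ℂ),
        Z₀.IsHermitian →
        (∀ i, IsSARandomMatrix (Z i)) →
        (∀ i a b, MemLp (fun ω => Z i ω a b) 2 P) →
        (∀ i, expect P (Z i) = 0) →
        iIndepFun (fun i ω (a b : Fin d) => Z i ω a b) P →
        IsGaussianModel P Q (model Z₀ Z) G →
        ∀ (p : ℕ) (z : ℂ), 1 ≤ p → 0 < z.im →
          ENNReal.ofReal
              |resolventMoment P (model Z₀ Z) z p - resolventMoment Q G z p| ≤
            ENNReal.ofReal C *
              ((Rparam P Z * ENNReal.ofReal (sigma P (model Z₀ Z)) ^ 2 * (p : ℝ≥0∞) ^ 2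
                  + Rparam P Z ^ 3 * (p : ℝ≥0∞) ^ 3) /
                ENNReal.ofReal (z.im ^ 4)) := by
  refine ⟨2016, by norm_num, ?_⟩
  intro d n hd Ω Ω' _ _ P Q _ _ Z₀ Z G hZ₀ hZ hL2 h0 hind hG p z hp hz
  have : NeZero d := ⟨by omega⟩
  have hpR : (1 : ℝ) ≤ p := by exact_mod_cast hp
  by_cases htop : Rparam P Z = ∞
  · -- without a bound on the summands the right-hand side is infinite
    have hp' : (p : ℝ≥0∞) ≠ 0 := by simp; omega
    rw [htop, ENNReal.top_pow (by norm_num), ENNReal.top_mul (pow_ne_zero 3 hp'), add_top,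
      ENNReal.top_div_of_ne_top ENNReal.ofReal_ne_top, ENNReal.mul_top (by simp)]
    exact le_top
  set R := (Rparam P Z).toReal with hRdef
  have hR0 : 0 ≤ R := ENNReal.toReal_nonneg
  have hσ0 : 0 ≤ sigma P (model Z₀ Z) := Real.sqrt_nonneg _
  have hreal : |resolventMoment P (model Z₀ Z) z p - resolventMoment Q G z p| ≤
      2016 * ((R * sigma P (model Z₀ Z) ^ 2 * p ^ 2 + R ^ 3 * p ^ 3) / z.im ^ 4) := by
    by_cases hε : p * R * z.im⁻¹ ≤ 1 / 6
    · refine (abs_resolventMoment_sub_le_of_small hp hZ hL2 h0 hind hZ₀ hG hR0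
        (ae_norm_le_of_Rparam htop) hz hε).trans ?_
      have e : 2016 * p ^ 2 * R * z.im⁻¹ ^ 4 * sigma P (model Z₀ Z) ^ 2 =
          2016 * ((R * sigma P (model Z₀ Z) ^ 2 * p ^ 2) / z.im ^ 4) := by
        field_simp
      rw [e]
      gcongr
      exact le_add_of_nonneg_right (by positivity)
    · -- both moments lie in `[0, 1 / Im z]`, and `1 / Im z` is at most `(6 p R)³ / (Im z)⁴`
      push Not at hε
      have hXm : Measurable (model Z₀ Z) :=
        (Finset.measurable_fun_sum _ fun i _ => (hZ i).measurable).const_add Z₀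
      have hXh : ∀ ω, (model Z₀ Z ω).IsHermitian := fun ω =>
        hZ₀.add (isHermitian_sum (fun i => (hZ i).isHermitian ω) _)
      obtain ⟨a1, a2⟩ := resolventMoment_nonneg_and_le (μ := P) hp hXm hXh hz
      obtain ⟨b1, b2⟩ := resolventMoment_nonneg_and_le (μ := Q) hp
        hG.saRandomMatrix.measurable hG.saRandomMatrix.isHermitian hz
      have h1 : |resolventMoment P (model Z₀ Z) z p - resolventMoment Q G z p| ≤ z.im⁻¹ :=
        abs_sub_le_iff.mpr ⟨by linarith, by linarith⟩
      have h2 : 1 ≤ (6 * (p * R * z.im⁻¹)) ^ 3 := one_le_pow₀ (by linarith)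
      have hη : 0 < z.im⁻¹ := inv_pos.mpr hz
      calc _ ≤ z.im⁻¹ * 1 := by rwa [mul_one]
        _ ≤ z.im⁻¹ * (6 * (p * R * z.im⁻¹)) ^ 3 := by gcongr
        _ = 216 * (R ^ 3 * p ^ 3 / z.im ^ 4) := by field_simp; ring
        _ ≤ 2016 * (R ^ 3 * p ^ 3 / z.im ^ 4) := by gcongr; norm_num
        _ ≤ _ := by
          gcongr
          exact le_add_of_nonneg_left (by positivity)
  refine (ENNReal.ofReal_le_ofReal hreal).trans (le_of_eq ?_)
  rw [ENNReal.ofReal_mul (by norm_num), ENNReal.ofReal_div_of_pos (by positivity),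
    ENNReal.ofReal_add (by positivity) (by positivity), ENNReal.ofReal_mul (by positivity),
    ENNReal.ofReal_mul hR0, ENNReal.ofReal_mul (by positivity), ENNReal.ofReal_pow hσ0,
    ENNReal.ofReal_pow (by positivity), ENNReal.ofReal_pow hR0, ENNReal.ofReal_pow (by positivity),
    ENNReal.ofReal_natCast, hRdef, ENNReal.ofReal_toReal htop]
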